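/- Let $k$ be a commutative ring, let $X$ and $Y$ be finite posets, and let $F : Y \to \mathcal{J}(X)$ be an order-preserving map to the poset of closed subsets (lower sets) of $X$, ordered by inclusion. Let $\Gamma = \{(x,y) \in X\times Y : x\in F(y)\}$ with the order induced from $X \times Y$. For a poset $P$, let $\mathcal{F}_{P,k}$ be the abelian category of functors from $P$ to $k$-modules (equivalently, of $k$-linear functors on the $k$-linearization of $P$). For $x \in P$ let $P_x, I_x\in \mathcal F_{P,k}$ be the functors $P_x=\mathrm{Hom}_{kP}(x,-)$ and $I_x=\mathrm{Hom}_k(\mathrm{Hom}_{kP}(-,x),k)$; thus $P_x(z)=k$ if $x\le z$ and $0$ otherwise, and $I_x(z)=k$ if $z\le x$ and $0$ otherwise. For $y\in Y$ let $i_y : F(y)\to\Gamma$, $x\mapsto (x,y)$, and let $(i_y)_\star : \mathcal{F}_{F(y),k}\to\mathcal{F}_{\Gamma,k}$ be the right adjoint of precomposition with $i_y$, given by $(i_y)_\star\phi(a,b)=\phi(a)$ if $b\le y$ and $0$ otherwise. Set $$T=\bigoplus_{y\in Y}\bigoplus_{x\in F(y)}(i_y)_\star(P_x),$$ viewed as a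 complex concentrated in degree $0$. Let $\mathrm{add}(T)$ denote the class of direct summands of finite direct sums of copies of $T$ in $D^b(\mathcal{F}_{\Gamma,k})$. Then $T$ is a tilting complex for $D^b(\mathcal{F}_{\Gamma,k})$, that is: 1. $T$ is isomorphic in $D^b(\mathcal{F}_{\Gamma,k})$ to a bounded complex of finitely generated projective objects of $\mathcal{F}_{\Gamma,k}$; 2. $\mathrm{Hom}_{D^b(\mathcal{F}_{\Gamma,k})}(T,T[i])=0$ for every integer $i\neq 0$; 3. the smallest strictly full triangulated subcategory of $D^b(\mathcal{F}_{\Gamma,k})$ containing $\mathrm{add}(T)$ is the full subcategory of objects isomorphic to bounded complexes of finitely generated projective objects, that is, the essential image of $K^b(\mathrm{proj}(\mathcal{F}_{\Gamma,k}))$. In addition, for every $(x,y)\in\Gamma$ the functor $I_{(x,y)}$, placed in degree $0$, lies in the smallest strictly full triangulated subcategory containing $\mathrm{add}(T)$. Finally, let $k\Gamma_0$ be the $k$-linear category whose objects are the elements of $\Gamma$, with $\mathrm{Hom}_{k\Gamma_0}((x,y),(x',y'))=k$ if $x\le x'$, $y\le y'$ and $x'\in F(y)$, and $0$ otherwise,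 composition being multiplication of scalars whenever the target Hom is $k$ (and zero otherwise). Let $\mathcal{F}_{\Gamma_0,k}$ be the category of $k$-linear functors from $k\Gamma_0$ to $k$-modules. Then there is an isomorphism of $k$-algebras $$\mathrm{End}_{D^b(\mathcal{F}_{\Gamma,k})}(T)\;\cong\;\mathrm{End}_{\mathcal{F}_{\Gamma_0,k}}\Big(\bigoplus_{(x,y)\in\Gamma}\mathrm{Hom}_{k\Gamma_0}\big((x,y),-\big)\Big).$$ -/

import Mathlib

open CategoryTheory Limits

universe w u v t

namespace PosetTilting

noncomputable section

attribute [local instance] Abelian.hasFiniteBiproducts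

/-! ### Generalized intervals -/

section Combinatorics

variable {X : Type u} {Y : Type v} [PartialOrder X] [PartialOrder Y]

/-- The poset `Γ` of generalized intervals of an order preserving map `F` from `Y` to the lattice
of lower sets of `X` : the pairs `(x, y)` with `x ∈ F y`, ordered as a subset of `X × Y`. -/
abbrev Gamma (F : Y →o LowerSet X) : Type (max u v) := {p : X × Y // p.1 ∈ F p.2}

/-- The order preserving inclusion `i_y : F y → Γ`, `x ↦ (x, y)`. -/
def incl (F : Y →o LowerSet X) (y : Y) : F y →o Gamma F where
  toFun x := ⟨((x : X), y), x.2⟩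
  monotone' _ _ h := ⟨h, le_rfl⟩

end Combinatorics

/-! ### Representations of a poset -/

section Representations

variable (k : Type w) [CommRing k]

/-- The category `𝓕_{P,k}` of representations of a poset `P` over `k` : functors from `P` (seen as
a category) to `k`-modules, that is, `k`-linear functors on the linearization of `P`. -/
abbrev Rep (P : Type t) [PartialOrder P] := P ⥤ ModuleCat.{w} k

variable {P : Type t} [PartialOrder P]

/-- The functor `P_x = Hom_{kP}(x, -)` : its value at `z` is the free `k`-module on the set of
morphisms `x ⟶ z` (one element if `x ≤ z`, none otherwise). -/
def projRep (x : P) : Rep k P where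
  obj z := ModuleCat.of k (PLift (x ≤ z) →₀ k)
  map f := ModuleCat.ofHom
    (Finsupp.lmapDomain k k (fun h => PLift.up (h.down.trans (leOfHom f))))
  map_id z := by
    ext : 1
    exact Finsupp.lmapDomain_id k k
  map_comp f g := by
    ext : 1
    exact Finsupp.lmapDomain_comp k k
      (fun h => PLift.up (h.down.trans (leOfHom f))) (fun h => PLift.up (h.down.trans (leOfHom g)))

/-- The functor `I_x = Hom_k(Hom_{kP}(-, x), k)` : its value at `z` is the `k`-module of `k`-valued
functions on the set of morphisms `z ⟶ x` (one element if `z ≤ x`, none otherwise). -/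
def injRep (x : P) : Rep k P where
  obj z := ModuleCat.of k (PLift (z ≤ x) → k)
  map f := ModuleCat.ofHom
    (LinearMap.funLeft k k (fun h => PLift.up ((leOfHom f).trans h.down)))
  map_id _ := rfl
  map_comp _ _ := rfl

variable {k}

/-- A representation is finitely generated if it is a quotient of a finite direct sum of
representations of the form `P_x`. -/
def IsFinGen (M : Rep k P) : Prop :=
  ∃ (n : ℕ) (x : Fin n → P) (f : (⨁ fun i => projRep k (x i)) ⟶ M), Epi f

end Representations

/-! ### The functor `(i_y)_⋆` -/

section Pushforward

variable (k : Type w) [CommRing k]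
variable {X : Type u} {Y : Type v} [PartialOrder X] [PartialOrder Y]

/-- If `(a, b) ∈ Γ` and `b ≤ y`, then `a ∈ F y`. -/
def baseChange (F : Y →o LowerSet X) (y : Y) (p : Gamma F) (h : p.1.2 ≤ y) : F y :=
  ⟨p.1.1, F.monotone h p.2⟩

/-- The representation `(i_y)_⋆ φ` of `Γ` : its value at `(a, b)` is the `k`-module of functions
from the set of morphisms `(a, b) ⟶ (a, y)` to `φ a`. This is `φ a` if `b ≤ y`, and `0` otherwise.
A morphism `(a, b) ⟶ (c, d)` acts by restriction along `b ≤ d` and by `φ (a ≤ c)`. -/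
def pushforwardObj (F : Y →o LowerSet X) (y : Y) (φ : Rep k (F y)) : Rep k (Gamma F) where
  obj p := ModuleCat.of k (∀ h : PLift (p.1.2 ≤ y), φ.obj (baseChange F y p h.down))
  map {p q} f := ModuleCat.ofHom (LinearMap.pi fun h : PLift (q.1.2 ≤ y) =>
    (φ.map (homOfLE (show baseChange F y p ((leOfHom f).2.trans h.down) ≤
      baseChange F y q h.down from (leOfHom f).1))).hom ∘ₗ
        LinearMap.proj (PLift.up ((leOfHom f).2.trans h.down)))
  map_id p := by
    refine ModuleCat.hom_ext (LinearMap.ext fun g => ?_)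
    funext h
    exact congrArg (fun m => m.hom (g h)) (φ.map_id (baseChange F y p h.down))
  map_comp {p q r} f g := by
    refine ModuleCat.hom_ext (LinearMap.ext fun s => ?_)
    funext h
    exact congrArg (fun m => m.hom (s (PLift.up
        (((leOfHom f).2.trans (leOfHom g).2).trans h.down))))
      (φ.map_comp
        (homOfLE (show baseChange F y p (((leOfHom f).2.trans (leOfHom g).2).trans h.down) ≤
          baseChange F y q ((leOfHom g).2.trans h.down) from (leOfHom f).1))
        (homOfLE (show baseChange F y q ((leOfHom g).2.trans h.down) ≤
          baseChange F y r h.down from (leOfHom g).1)))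

/-- The functor `(i_y)_⋆` from representations of `F y` to representations of `Γ`, the right
adjoint of restriction along `i_y`. -/
def pushforward (F : Y →o LowerSet X) (y : Y) : Rep k (F y) ⥤ Rep k (Gamma F) where
  obj φ := pushforwardObj k F y φ
  map {φ ψ} η :=
    { app := fun p => ModuleCat.ofHom (LinearMap.pi fun h =>
        (η.app (baseChange F y p h.down)).hom ∘ₗ LinearMap.proj h)
      naturality := fun p q f => by
        refine ModuleCat.hom_ext (LinearMap.ext fun s => ?_)
        funext h
        exact congrArg (fun m => m.hom (s (PLift.up ((leOfHom f).2.trans h.down))))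
          (η.naturality (homOfLE (show baseChange F y p ((leOfHom f).2.trans h.down) ≤
            baseChange F y q h.down from (leOfHom f).1))) }
  map_id _ := rfl
  map_comp _ _ := rfl

/-- The restriction functor `i_y⁻¹`, precomposition with `i_y`. -/
def restriction (F : Y →o LowerSet X) (y : Y) : Rep k (Gamma F) ⥤ Rep k (F y) :=
  (Functor.whiskeringLeft _ _ _).obj (incl F y).monotone.functor

/-- The functor `(i_y)_⋆` is indeed right adjoint to restriction along `i_y`. -/
def restrictionAdjunction (F : Y →o LowerSet X) (y : Y) :
    restriction k F y ⊣ pushforward k F y :=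
  Adjunction.mkOfUnitCounit
    { unit :=
        { app := fun M =>
            { app := fun p => ModuleCat.ofHom (LinearMap.pi fun h =>
                (M.map (homOfLE (show p ≤ incl F y (baseChange F y p h.down) from
                  ⟨le_rfl, h.down⟩))).hom)
              naturality := fun p q f => by
                refine ModuleCat.hom_ext (LinearMap.ext fun s => ?_)
                funext h
                have e₁ := M.map_comp f (homOfLE (show q ≤ incl F y (baseChange F y q h.down) from
                  ⟨le_rfl, h.down⟩))
                have e₂ := M.map_comp
                  (homOfLE (show p ≤ incl F y (baseChange F y p ((leOfHom f).2.trans h.down)) from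
                    ⟨le_rfl, (leOfHom f).2.trans h.down⟩))
                  (homOfLE (show incl F y (baseChange F y p ((leOfHom f).2.trans h.down)) ≤
                    incl F y (baseChange F y q h.down) from ⟨(leOfHom f).1, le_rfl⟩))
                exact congrArg (fun m => m.hom s) (e₁.symm.trans e₂) }
          naturality := fun M N η => by
            ext p s
            funext h
            exact congrArg (fun m => m.hom s) (η.naturality
              (homOfLE (show p ≤ incl F y (baseChange F y p h.down) from
                ⟨le_rfl, h.down⟩))).symm }
      counit :=
        { app := fun φ =>
            { app := fun x => ModuleCat.ofHom
                (LinearMap.proj (PLift.up (le_refl y)))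
              naturality := fun _ _ _ => rfl }
          naturality := fun _ _ _ => rfl }
      left_triangle := by
        ext M x s
        exact congrArg (fun m => m.hom s) (M.map_id (incl F y x))
      right_triangle := by
        ext φ p s
        funext h
        exact congrArg (fun m => m.hom (s h)) (φ.map_id (baseChange F y p h.down)) }

variable [Finite X] [Finite Y]

/-- The representation `⨁_{y ∈ Y} ⨁_{x ∈ F y} (i_y)_⋆ (P_x)` of `Γ`. -/
def tiltingRep (F : Y →o LowerSet X) : Rep k (Gamma F) :=
  ⨁ fun y : Y => ⨁ fun x : F y => (pushforward k F y).obj (projRep k x)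

end Pushforward

/-! ### Tilting complexes -/

section Triangulated

variable {C : Type*} [Category* C] [HasZeroObject C] [HasShift C ℤ] [Preadditive C]
  [∀ n : ℤ, (shiftFunctor C n).Additive] [Pretriangulated C]

/-- `add T` : the direct summands of finite direct sums of copies of `T`. -/
def addClosure (T : C) : ObjectProperty C := fun K =>
  ∃ n : ℕ, Nonempty (Retract K (⨁ fun _ : Fin n => T))

/-- The objects of the smallest (strictly full) triangulated subcategory containing `S`. -/
def triangulatedHull (S : ObjectProperty C) : ObjectProperty C := fun K =>
  ∀ Q : ObjectProperty C, Q.IsTriangulated → Q.IsClosedUnderIsomorphisms → S ≤ Q → Q K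

end Triangulated

section Derived

variable {A : Type*} [Category* A] [Abelian A] [HasDerivedCategory.{t} A]

/-- An object of `A`, seen as a complex concentrated in degree `0`, in the bounded derived
category of `A`. -/
def toBounded (M : A) : DerivedCategory.Bounded A :=
  ⟨(DerivedCategory.singleFunctor A 0).obj M, ⟨⟨0, inferInstance⟩, ⟨0, inferInstance⟩⟩⟩

end Derived

section Tilting

variable {k : Type w} [CommRing k] {P : Type u} [PartialOrder P] [HasDerivedCategory.{t} (Rep k P)]

/-- The essential image of `K^b(proj)` in the bounded derived category of representations of `P` :
the objects isomorphic to a bounded complex of finitely generated projective representations. -/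
def perfect : ObjectProperty (DerivedCategory.Bounded (Rep k P)) := fun K =>
  ∃ L : CochainComplex (Rep k P) ℤ,
    (∀ i : ℤ, Projective (L.X i) ∧ IsFinGen (L.X i)) ∧
    (∃ a : ℤ, L.IsStrictlyGE a) ∧ (∃ b : ℤ, L.IsStrictlyLE b) ∧
    Nonempty (K.obj ≅ DerivedCategory.Q.obj L)

/-- Tilting complexes in the bounded derived category of representations of `P`. -/
structure IsTiltingComplex (T : DerivedCategory.Bounded (Rep k P)) : Prop where
  perfect : perfect T
  hom_shift_eq_zero : ∀ i : ℤ, i ≠ 0 → ∀ f : T ⟶ (shiftFunctor _ i).obj T, f = 0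
  generates : triangulatedHull (addClosure T) = PosetTilting.perfect (k := k) (P := P)

end Tilting

/-! ### The linear category `kΓ₀` -/

section GammaZero

variable (k : Type w) [CommRing k]
variable {X : Type u} {Y : Type v} [PartialOrder X] [PartialOrder Y]

/-- The objects of `kΓ₀` are the elements of `Γ`. -/
@[ext]
structure GammaZero (k : Type w) (F : Y →o LowerSet X) : Type (max u v) where
  /-- the underlying generalized interval -/
  pt : Gamma F

namespace GammaZero

variable {k} {F : Y →o LowerSet X}

set_option linter.unusedSectionVars false

/-- The condition for `Hom_{kΓ₀}((x, y), (x', y'))` to be `k`. -/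
def Rel (p q : GammaZero k F) : Prop :=
  p.pt.1.1 ≤ q.pt.1.1 ∧ p.pt.1.2 ≤ q.pt.1.2 ∧ q.pt.1.1 ∈ F p.pt.1.2

open Classical in
/-- `Hom_{kΓ₀}((x, y), (x', y'))` as a submodule of `k` : it is `k` if `x ≤ x'`, `y ≤ y'` and
`x' ∈ F y`, and `0` otherwise. -/
def homSubmodule (p q : GammaZero k F) : Submodule k k :=
  if Rel p q then ⊤ else ⊥

lemma Rel.refl (p : GammaZero k F) : Rel p p := ⟨le_rfl, le_rfl, p.pt.2⟩

lemma eq_zero_of_not_rel {p q : GammaZero k F} (h : ¬ Rel p q) (f : homSubmodule p q) :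
    (f : k) = 0 := by
  have hf := f.2
  simpa only [homSubmodule, if_neg h, Submodule.mem_bot] using hf

lemma mem_of_rel {p q : GammaZero k F} (h : Rel p q) (r : k) : r ∈ homSubmodule p q := by
  simp only [homSubmodule, if_pos h, Submodule.mem_top]

open Classical in
/-- The composition of `kΓ₀` : scalar multiplication whenever the target is `k`. -/
def comp {p q r : GammaZero k F} (f : homSubmodule p q) (g : homSubmodule q r) :
    homSubmodule p r :=
  ⟨if Rel p r then (f : k) * (g : k) else 0, by
    by_cases h : Rel p r
    · exact mem_of_rel h _
    · rw [if_neg h]; exact zero_mem _⟩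

lemma comp_val {p q r : GammaZero k F} (h : Rel p r) (f : homSubmodule p q)
    (g : homSubmodule q r) : (comp f g : k) = (f : k) * (g : k) := by
  simp only [comp, if_pos h]

/-- The `k`-linear category `kΓ₀`. -/
instance : Category (GammaZero k F) where
  Hom p q := homSubmodule p q
  id p := ⟨1, mem_of_rel (Rel.refl p) 1⟩
  comp f g := comp f g
  id_comp {p q} f := by
    by_cases h : Rel p q
    · exact Subtype.ext ((comp_val h _ _).trans (one_mul _))
    · exact Subtype.ext ((eq_zero_of_not_rel h _).trans (eq_zero_of_not_rel h _).symm)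
  comp_id {p q} f := by
    by_cases h : Rel p q
    · exact Subtype.ext ((comp_val h _ _).trans (mul_one _))
    · exact Subtype.ext ((eq_zero_of_not_rel h _).trans (eq_zero_of_not_rel h _).symm)
  assoc {p q r s} f g h := by
    refine Subtype.ext ?_
    by_cases hps : Rel p s
    · rw [comp_val hps, comp_val hps]
      by_cases hpq : Rel p q
      · by_cases hrs : Rel r s
        · by_cases hqr : Rel q r
          · have hpr : Rel p r := ⟨hpq.1.trans hqr.1, hpq.2.1.trans hqr.2.1,
              (F p.pt.1.2).lower hrs.1 hps.2.2⟩
            have hqs : Rel q s := ⟨hqr.1.trans hrs.1, hqr.2.1.trans hrs.2.1,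
              F.monotone hpq.2.1 hps.2.2⟩
            rw [comp_val hpr, comp_val hqs, mul_assoc]
          · have hg := eq_zero_of_not_rel hqr g
            simp [comp, hg]
        · simp [comp, eq_zero_of_not_rel hrs h]
      · simp [comp, eq_zero_of_not_rel hpq f]
    · exact (eq_zero_of_not_rel hps _).trans (eq_zero_of_not_rel hps _).symm

instance : Preadditive (GammaZero k F) where
  homGroup p q := inferInstanceAs (AddCommGroup (homSubmodule p q))
  add_comp p q r f f' g := by
    refine Subtype.ext ?_
    by_cases h : Rel p r
    · exact (comp_val h _ _).trans ((add_mul (f : homSubmodule p q).1 f'.1 g.1).trans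
        (congrArg₂ (· + ·) (comp_val h f g).symm (comp_val h f' g).symm))
    · exact (eq_zero_of_not_rel h _).trans (eq_zero_of_not_rel h _).symm
  comp_add p q r f g g' := by
    refine Subtype.ext ?_
    by_cases h : Rel p r
    · exact (comp_val h _ _).trans ((mul_add (f : homSubmodule p q).1 g.1 g'.1).trans
        (congrArg₂ (· + ·) (comp_val h f g).symm (comp_val h f g').symm))
    · exact (eq_zero_of_not_rel h _).trans (eq_zero_of_not_rel h _).symm

instance : Linear k (GammaZero k F) where
  homModule p q := inferInstanceAs (Module k (homSubmodule p q))
  smul_comp p q r c f g := by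
    refine Subtype.ext ?_
    by_cases h : Rel p r
    · exact (comp_val h _ _).trans ((mul_assoc c (f : homSubmodule p q).1 g.1).trans
        (congrArg (c * ·) (comp_val h f g).symm))
    · exact (eq_zero_of_not_rel h _).trans (eq_zero_of_not_rel h _).symm
  comp_smul p q r f c g := by
    refine Subtype.ext ?_
    by_cases h : Rel p r
    · exact (comp_val h _ _).trans ((mul_left_comm (f : homSubmodule p q).1 c g.1).trans
        (congrArg (c * ·) (comp_val h f g).symm))
    · exact (eq_zero_of_not_rel h _).trans (eq_zero_of_not_rel h _).symm

end GammaZero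

variable (F : Y →o LowerSet X)

/-- The category `𝓕_{Γ₀,k}` of `k`-linear functors from `kΓ₀` to `k`-modules. -/
abbrev RepZero := ObjectProperty.FullSubcategory
  (fun M : GammaZero k F ⥤ ModuleCat.{w} k => M.Additive ∧ M.Linear k)

/-- Morphisms act on a finite direct sum of functors diagonally. -/
lemma biproduct_map_eq {ι : Type*} [Fintype ι] (M : ι → GammaZero k F ⥤ ModuleCat.{w} k)
    {p q : GammaZero k F} (f : p ⟶ q) : (⨁ M).map f =
      ∑ i, (biproduct.π M i).app p ≫ (M i).map f ≫ (biproduct.ι M i).app q := by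
  have h₀ : ∑ i, biproduct.π M i ≫ biproduct.ι M i = 𝟙 (⨁ M) := by
    classical
    refine biproduct.hom_ext _ _ fun j => ?_
    simp [Preadditive.sum_comp, biproduct.ι_π, comp_dite]
  have h := congrArg (fun η => (⨁ M).map f ≫ NatTrans.app η q) h₀
  simp only [NatTrans.app_sum, Preadditive.comp_sum, NatTrans.comp_app, NatTrans.id_app,
    Category.comp_id, NatTrans.naturality_assoc] at h
  exact h.symm

variable [Finite X] [Finite Y]

instance : Finite (GammaZero k F) := Finite.of_injective GammaZero.pt fun _ _ => GammaZero.ext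

/-- The direct sum, over the objects `(x, y)` of `kΓ₀`, of the representable functors
`P_{(x, y)} = Hom_{kΓ₀}((x, y), -)`. -/
def projSumZero : RepZero k F where
  obj := ⨁ fun p : GammaZero k F => (linearCoyoneda k (GammaZero k F)).obj (Opposite.op p)
  property := by
    have := Fintype.ofFinite (GammaZero k F)
    constructor
    · constructor
      intro p q f g
      simp only [biproduct_map_eq, Functor.map_add, Preadditive.add_comp, Preadditive.comp_add,
        Finset.sum_add_distrib]
    · constructor
      intro p q f r
      have h : ∀ a : GammaZero k F,
          ((linearCoyoneda k (GammaZero k F)).obj (Opposite.op a)).map (r • f) =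
            r • ((linearCoyoneda k (GammaZero k F)).obj (Opposite.op a)).map f := fun a => by
        refine ModuleCat.hom_ext (LinearMap.ext fun s => ?_)
        exact Linear.comp_smul _ _ _ s r f
      simp only [biproduct_map_eq, h, Linear.smul_comp, Linear.comp_smul, Finset.smul_sum]

end GammaZero

end

end PosetTilting

namespace PosetTilting

noncomputable section

attribute [local instance] Abelian.hasFiniteBiproducts

/-! The summand of `T` indexed by `p = (x, y)` is the constant functor `k` truncated to `tiltSet p =
{(a, b) | x ≤ a, b ≤ y}`, an order convex subset of `Γ`. All three claims are read off from these
supports.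

Generation is a triangular inversion. `tiltSet p` contains `p`, and its other points are strictly
below `p` for the order of `Xᵒᵖ × Y`. Peeling off points one at a time by short exact sequences,
induction along that order puts every constant functor with finitely generated projective value
truncated to a single point into the hull of `add T`, hence every pointwise finitely generated
projective functor (`IsThick.mem_of_forall_finProj`). This covers the `I_p` and the terms of perfect
complexes. The same lemma, applied to the supports `Set.Ici p` of the projectives `P_p`, shows that
`T` is perfect.

Vanishing comes from the adjunction between `i_y⁻¹` and `(i_y)_⋆`. The exact functor `i_y⁻¹`
preserves enough projectives and sends `T` to a projective, so `Ext` in positive degrees from `T` to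
any `(i_y)_⋆ N` is zero (`ext_eq_zero_of_adjunction`).

For endomorphisms, a morphism from summand `p = (x, y)` to summand `q = (x', y')` is a scalar, read
at the corner `(x, y')`. It can be nonzero only if `x' ≤ x`, `y' ≤ y` and `x ∈ F y'`, which is the
condition defining `Hom_{kΓ₀}(q, p)` (`tiltMapEquiv`). Yoneda for `kΓ₀` reverses arrows in the same
way, so the two matrix algebras agree. -/

section Resolutions

open Pretriangulated DerivedCategory ZeroObject

/-! ### Bounded complexes of projectives as a triangulated subcategory -/

section BoundedComplexes

variable {A : Type*} [Category* A] [Abelian A] [HasDerivedCategory.{t} A]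

/-- The objects of the derived category isomorphic to a bounded complex with terms in `S`. -/
def boundedResolved (S : ObjectProperty A) : ObjectProperty (DerivedCategory A) := fun K =>
  ∃ L : CochainComplex A ℤ, (∀ i, S (L.X i)) ∧ (∃ a : ℤ, L.IsStrictlyGE a) ∧
    (∃ b : ℤ, L.IsStrictlyLE b) ∧ Nonempty (K ≅ Q.obj L)

variable (S : ObjectProperty A)

instance : (boundedResolved S).IsClosedUnderIsomorphisms where
  of_iso := by
    rintro K K' e ⟨L, h, ha, hb, ⟨e'⟩⟩
    exact ⟨L, h, ha, hb, ⟨e.symm ≪≫ e'⟩⟩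

instance : (boundedResolved S).IsStableUnderShift ℤ where
  isStableUnderShiftBy n := ⟨by
    rintro K ⟨L, h, ⟨a, ha⟩, ⟨b, hb⟩, ⟨e⟩⟩
    exact ⟨L⟦n⟧, fun i => h (i + n), ⟨a - n, L.isStrictlyGE_shift a n _ (by lia)⟩,
      ⟨b - n, L.isStrictlyLE_shift b n _ (by lia)⟩,
      ⟨(shiftFunctor _ n).mapIso e ≪≫ (Q.commShiftIso n).symm.app L⟩⟩⟩

instance [S.ContainsZero] [S.IsClosedUnderIsomorphisms] :
    (boundedResolved S).ContainsZero where
  exists_zero := by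
    have hz : IsZero (0 : CochainComplex A ℤ) := isZero_zero _
    have hX : ∀ i, IsZero ((0 : CochainComplex A ℤ).X i) := fun i =>
      (HomologicalComplex.eval A _ i).map_isZero hz
    refine ⟨Q.obj 0, Q.map_isZero hz, 0, fun i => S.prop_of_isZero (hX i), ⟨0, ?_⟩, ⟨0, ?_⟩,
      ⟨Iso.refl _⟩⟩
    · rw [CochainComplex.isStrictlyGE_iff]
      exact fun i _ => hX i
    · rw [CochainComplex.isStrictlyLE_iff]
      exact fun i _ => hX i

/-- Out of a K-projective complex, morphisms in the derived category agree with homotopy classes,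
and a homotopy class is represented by a chain map. -/
lemma exists_Q_map_eq {K L : CochainComplex A ℤ} [K.IsKProjective] (f : Q.obj K ⟶ Q.obj L) :
    ∃ g : K ⟶ L, Q.map g = f := by
  obtain ⟨g, hg⟩ := (CochainComplex.IsKProjective.Qh_map_bijective K _).surjective
    ((quotientCompQhIso A).hom.app K ≫ f ≫ (quotientCompQhIso A).inv.app L)
  obtain ⟨g, rfl⟩ := (HomotopyCategory.quotient _ _).map_surjective g
  refine ⟨g, ?_⟩
  have h := (quotientCompQhIso A).hom.naturality g
  dsimp at h
  rw [← cancel_epi ((quotientCompQhIso A).hom.app K), ← h, hg]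
  simp

/-- A bounded complex of projectives is K-projective, so the first map of the triangle lifts to a
chain map `g`. The third vertex is then the cone of `g`, whose terms are `K.X (i + 1) ⊞ L.X i`. -/
lemma boundedResolved_isTriangulatedClosed₃ [S.IsClosedUnderIsomorphisms]
    (hproj : ∀ M, S M → Projective M) (hbiprod : ∀ M N, S M → S N → S (M ⊞ N)) :
    (boundedResolved S).IsTriangulatedClosed₃ := by
  refine .mk' ?_
  rintro T hT ⟨K, hK, ⟨a, ha⟩, ⟨b, hb⟩, ⟨e⟩⟩ ⟨L, hL, ⟨a', ha'⟩, ⟨b', hb'⟩, ⟨e'⟩⟩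
  have := fun n => hproj _ (hK n)
  have := CochainComplex.isKProjective_of_projective K b
  obtain ⟨g, hg⟩ := exists_Q_map_eq (e.inv ≫ T.mor₁ ≫ e'.hom)
  have e'' := isoTriangleOfIso₁₂ _ _ hT (DerivedCategory.mappingCone_triangle_distinguished g) e e'
    (by change T.mor₁ ≫ e'.hom = e.hom ≫ Q.map g; simp [hg])
  have hX : ∀ i, Nonempty ((CochainComplex.mappingCone g).X i ≅ K.X (i + 1) ⊞ L.X i) := fun i =>
    ⟨HomologicalComplex.homotopyCofiber.XIsoBiprod g i (i + 1) rfl⟩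
  have hz : ∀ i, IsZero (K.X (i + 1)) → IsZero (L.X i) →
      IsZero ((CochainComplex.mappingCone g).X i) := fun i h h' =>
    ((biprod_isZero_iff _ _).2 ⟨h, h'⟩).of_iso (hX i).some
  refine ⟨CochainComplex.mappingCone g, fun i => S.prop_of_iso (hX i).some.symm
    (hbiprod _ _ (hK _) (hL _)), ⟨min (a - 1) a', ?_⟩, ⟨max (b - 1) b', ?_⟩,
    ⟨Triangle.π₃.mapIso e''⟩⟩
  · rw [CochainComplex.isStrictlyGE_iff]
    exact fun i hi => hz i (K.isZero_of_isStrictlyGE a _ (by lia))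
      (L.isZero_of_isStrictlyGE a' _ (by lia))
  · rw [CochainComplex.isStrictlyLE_iff]
    exact fun i hi => hz i (K.isZero_of_isStrictlyLE b _ (by lia))
      (L.isZero_of_isStrictlyLE b' _ (by lia))

lemma boundedResolved_isTriangulated [S.IsClosedUnderIsomorphisms] [S.ContainsZero]
    (hproj : ∀ M, S M → Projective M) (hbiprod : ∀ M N, S M → S N → S (M ⊞ N)) :
    (boundedResolved S).IsTriangulated :=
  have := boundedResolved_isTriangulatedClosed₃ S hproj hbiprod
  have := ObjectProperty.IsTriangulatedClosed₂.of_isTriangulatedClosed₃ (P := boundedResolved S)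
  { }

variable {S}

lemma single_mem_of_isTriangulated (R : ObjectProperty (DerivedCategory A)) [R.IsTriangulated]
    [R.IsClosedUnderIsomorphisms] {M : A} (hM : R ((singleFunctor A 0).obj M)) (n : ℤ) :
    R ((singleFunctor A n).obj M) := by
  have e := ((singleFunctors A).shiftIso n 0 n (by lia)).app M
  rw [← R.prop_shift_iff_of_isStableUnderShift _ n]
  exact R.prop_of_iso e.symm hM

/-- Induction on length by brutal truncation: `L` maps onto its lowest term, placed in degree `a`,
and the kernel is `L` with that term removed. -/
lemma Q_obj_mem_of_isTriangulated [S.IsClosedUnderIsomorphisms] [S.ContainsZero]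
    (R : ObjectProperty (DerivedCategory A)) [R.IsTriangulated]
    [R.IsClosedUnderIsomorphisms] (h : ∀ M, S M → R ((singleFunctor A 0).obj M)) (b : ℤ) (n : ℕ)
    (L : CochainComplex A ℤ) (hL : ∀ i, S (L.X i)) [L.IsStrictlyLE b]
    [L.IsStrictlyGE (b - n)] : R (Q.obj L) := by
  induction n generalizing b L with
  | zero =>
    have : L.IsStrictlyGE b := by simpa using ‹L.IsStrictlyGE (b - (0 : ℕ))›
    obtain ⟨M, ⟨e⟩⟩ := CochainComplex.exists_iso_single L b
    have hM : S M := S.prop_of_iso ((HomologicalComplex.eval A _ b).mapIso e ≪≫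
      HomologicalComplex.singleObjXSelf (.up ℤ) b M) (hL b)
    exact R.prop_of_iso (Q.mapIso e).symm (single_mem_of_isTriangulated R (h M hM) b)
  | succ n ih =>
    set a : ℤ := b - (n + 1 : ℕ) with ha
    let f : L ⟶ (HomologicalComplex.single A (.up ℤ) a).obj (L.X a) :=
      HomologicalComplex.mkHomToSingle (𝟙 _) (fun i hi =>
        (L.isZero_of_isStrictlyGE a i (by simp at hi; lia)).eq_of_src _ _)
    have hfa : IsIso (f.f a) := by
      simp only [f, HomologicalComplex.mkHomToSingle_f]
      infer_instance
    have hz : ∀ i, i ≠ a →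
        IsZero (((HomologicalComplex.single A (.up ℤ) a).obj (L.X a)).X i) := fun i hi =>
      HomologicalComplex.isZero_single_obj_X _ _ _ _ hi
    have hf : Epi f := by
      refine HomologicalComplex.epi_of_epi_f _ fun i => ?_
      by_cases hi : i = a
      · subst hi; infer_instance
      · exact ⟨fun _ _ _ => (hz i hi).eq_of_src _ _⟩
    have hK : ∀ i, Nonempty ((kernel f).X i ≅ kernel (f.f i)) := fun i =>
      ⟨PreservesKernel.iso (HomologicalComplex.eval A _ i) f⟩
    have hKa : IsZero ((kernel f).X a) :=
      (isZero_kernel_of_mono (f.f a)).of_iso (hK a).some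
    have hKi : ∀ i, i ≠ a → Nonempty ((kernel f).X i ≅ L.X i) := fun i hi => by
      have h0 : f.f i = 0 := (hz i hi).eq_of_tgt _ _
      have : IsIso (kernel.ι (f.f i)) := by
        rw [h0]; infer_instance
      exact ⟨(hK i).some ≪≫ asIso (kernel.ι (f.f i))⟩
    have hGE : (kernel f).IsStrictlyGE (b - n) := by
      rw [CochainComplex.isStrictlyGE_iff]
      intro i hi
      by_cases hia : i = a
      · subst hia; exact hKa
      · exact (L.isZero_of_isStrictlyGE a i (by push_cast at ha; lia)).of_iso (hKi i hia).some
    have hLE : (kernel f).IsStrictlyLE b := by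
      rw [CochainComplex.isStrictlyLE_iff]
      intro i hi
      exact (L.isZero_of_isStrictlyLE b i hi).of_iso (hKi i (by push_cast at ha; lia)).some
    have hmem : ∀ i, S ((kernel f).X i) := fun i => by
      by_cases hia : i = a
      · subst hia; exact S.prop_of_isZero hKa
      · exact S.prop_of_iso (hKi i hia).some.symm (hL i)
    have hS : (ShortComplex.mk (kernel.ι f) f (kernel.condition f)).ShortExact :=
      { exact := ShortComplex.exact_of_f_is_kernel _ (kernelIsKernel f)
        mono_f := inferInstanceAs (Mono (kernel.ι f))
        epi_g := hf }
    exact R.ext_of_isTriangulatedClosed₂ _ (triangleOfSES_distinguished hS) (ih b _ hmem)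
      (single_mem_of_isTriangulated R (h _ (hL a)) a)

lemma boundedResolved_le [S.IsClosedUnderIsomorphisms] [S.ContainsZero]
    (R : ObjectProperty (DerivedCategory A)) [R.IsTriangulated]
    [R.IsClosedUnderIsomorphisms] (h : ∀ M, S M → R ((singleFunctor A 0).obj M)) :
    boundedResolved S ≤ R := by
  rintro K ⟨L, hL, ⟨a, ha⟩, ⟨b, hb⟩, ⟨e⟩⟩
  have : L.IsStrictlyGE (b - (b - a).toNat) := L.isStrictlyGE_of_ge _ a (by lia)
  exact R.prop_of_iso e.symm (Q_obj_mem_of_isTriangulated R h b (b - a).toNat L hL)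

lemma boundedResolved_single [S.IsClosedUnderIsomorphisms] [S.ContainsZero] {M : A} (hM : S M) :
    boundedResolved S ((singleFunctor A 0).obj M) := by
  refine ⟨(HomologicalComplex.single A (.up ℤ) 0).obj M, fun i => ?_, ⟨0, inferInstance⟩,
    ⟨0, inferInstance⟩, ⟨Iso.refl _⟩⟩
  by_cases hi : i = 0
  · subst hi
    exact S.prop_of_iso (HomologicalComplex.singleObjXSelf _ 0 M).symm hM
  · exact S.prop_of_isZero (HomologicalComplex.isZero_single_obj_X _ _ _ _ hi)

end BoundedComplexes

/-! ### Two out of three for short exact sequences -/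

section ShortExact

variable {A : Type*} [Category* A] [Abelian A] [HasDerivedCategory.{t} A]

/-- A property of objects of an abelian category which satisfies the two out of three property
for short exact sequences. -/
structure IsThick (S : ObjectProperty A) : Prop where
  zero : ∀ M, IsZero M → S M
  iso : ∀ {M N : A}, (M ≅ N) → S M → S N
  left : ∀ {T : ShortComplex A}, T.ShortExact → S T.X₂ → S T.X₃ → S T.X₁
  middle : ∀ {T : ShortComplex A}, T.ShortExact → S T.X₁ → S T.X₃ → S T.X₂
  right : ∀ {T : ShortComplex A}, T.ShortExact → S T.X₁ → S T.X₂ → S T.X₃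

/-- Short exact sequences give distinguished triangles; this moves the dévissage from the derived
category to the abelian one. -/
lemma isThick_single (R : ObjectProperty (DerivedCategory A)) [R.IsTriangulated]
    [R.IsClosedUnderIsomorphisms] : IsThick (R.inverseImage (singleFunctor A 0)) where
  zero _ hM := R.prop_of_isZero ((singleFunctor A 0).map_isZero hM)
  iso e h := R.prop_of_iso ((singleFunctor A 0).mapIso e) h
  left hS h h' := R.ext_of_isTriangulatedClosed₁ _ hS.singleTriangle_distinguished h h'
  middle hS h h' := R.ext_of_isTriangulatedClosed₂ _ hS.singleTriangle_distinguished h h'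
  right hS h h' := R.ext_of_isTriangulatedClosed₃ _ hS.singleTriangle_distinguished h h'

end ShortExact

end Resolutions

/-! ### Truncation to convex subsets and dévissage -/

section Cut

variable {k : Type w} [CommRing k] {P : Type t} [PartialOrder P]

/-- The module of functions on the proofs of `p` with values in `N`, when `p` holds. -/
def funIso {p : Prop} (h : p) (N : ModuleCat.{w} k) : ModuleCat.of k (PLift p → N) ≅ N :=
  haveI : Unique (PLift p) := ⟨⟨⟨h⟩⟩, fun _ => rfl⟩
  (LinearEquiv.funUnique (PLift p) k N).toModuleIso

lemma isZero_fun {p : Prop} (h : ¬ p) (N : ModuleCat.{w} k) :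
    IsZero (ModuleCat.of k (PLift p → N)) :=
  haveI : IsEmpty (PLift p) := ⟨fun x => h x.down⟩
  ModuleCat.isZero_of_subsingleton _

open Classical in
/-- The representation which coincides with `M` on the order convex subset `C` and vanishes
elsewhere. -/
def cut (M : Rep k P) (C : Set P) (hC : C.OrdConnected) : Rep k P where
  obj q := ModuleCat.of k (PLift (q ∈ C) → M.obj q)
  map {p q} f := if h : p ∈ C ∧ q ∈ C then
    (funIso h.1 (M.obj p)).hom ≫ M.map f ≫ (funIso h.2 (M.obj q)).inv else 0
  map_id p := by
    by_cases h : p ∈ C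
    · simp [h]
    · exact (isZero_fun h _).eq_of_src _ _
  map_comp {p q r} f g := by
    by_cases hp : p ∈ C
    · by_cases hr : r ∈ C
      · have hq : q ∈ C := hC.out hp hr ⟨leOfHom f, leOfHom g⟩
        simp [hp, hq, hr]
      · exact (isZero_fun hr _).eq_of_tgt _ _
    · exact (isZero_fun hp _).eq_of_src _ _

variable {M N L : Rep k P} {C D E : Set P} {hC : C.OrdConnected} {hD : D.OrdConnected}
  {hE : E.OrdConnected}

variable (M hC) in
/-- The value of `cut M C` at an element of `C`. -/
def cutIso {q : P} (h : q ∈ C) : (cut M C hC).obj q ≅ M.obj q := funIso h _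

variable (M hC) in
lemma isZero_cut_obj {q : P} (h : q ∉ C) : IsZero ((cut M C hC).obj q) := isZero_fun h _

lemma cut_map {p q : P} (f : p ⟶ q) (hp : p ∈ C) (hq : q ∈ C) :
    (cut M C hC).map f = (cutIso M hC hp).hom ≫ M.map f ≫ (cutIso M hC hq).inv :=
  dif_pos ⟨hp, hq⟩

/-- The condition for a morphism `M ⟶ N` to induce a morphism `cut M C ⟶ cut N D`. -/
def CutCompatible (C D : Set P) : Prop :=
  ∀ ⦃p q : P⦄, p ≤ q → p ∈ C → q ∈ D → (q ∈ C ↔ p ∈ D)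

open Classical in
/-- The morphism between truncated representations which is given by `η` on the intersection. -/
def cutMap (η : M ⟶ N) (hC : C.OrdConnected) (hD : D.OrdConnected) (h : CutCompatible C D) :
    cut M C hC ⟶ cut N D hD where
  app q := if h : q ∈ C ∧ q ∈ D then
    (cutIso M hC h.1).hom ≫ η.app q ≫ (cutIso N hD h.2).inv else 0
  naturality p q f := by
    by_cases hpC : p ∈ C
    · by_cases hqD : q ∈ D
      · have := h (leOfHom f) hpC hqD
        by_cases hqC : q ∈ C
        · have hpD : p ∈ D := by tauto
          simp [hpC, hqD, hqC, hpD, cut_map]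
        · have hpD : p ∉ D := by tauto
          simp [hpD, hqC]
      · exact (isZero_cut_obj _ _ hqD).eq_of_tgt _ _
    · exact (isZero_cut_obj _ _ hpC).eq_of_src _ _

lemma cutMap_app (η : M ⟶ N) (h : CutCompatible C D) {q : P} (hqC : q ∈ C) (hqD : q ∈ D) :
    (cutMap η hC hD h).app q = (cutIso M hC hqC).hom ≫ η.app q ≫ (cutIso N hD hqD).inv :=
  dif_pos ⟨hqC, hqD⟩

lemma cut_hom_ext {f g : cut M C hC ⟶ cut N D hD}
    (h : ∀ q : P, q ∈ C → q ∈ D → f.app q = g.app q) : f = g := by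
  refine NatTrans.ext (funext fun q => ?_)
  by_cases hqC : q ∈ C
  · by_cases hqD : q ∈ D
    · exact h q hqC hqD
    · exact (isZero_cut_obj _ _ hqD).eq_of_tgt _ _
  · exact (isZero_cut_obj _ _ hqC).eq_of_src _ _

/-- `hCE` is needed because the composite through `D` vanishes at points of `C ∩ E` outside `D`. -/
lemma cutMap_comp (η : M ⟶ N) (θ : N ⟶ L) (h : CutCompatible C D) (h' : CutCompatible D E)
    (h'' : CutCompatible C E) (hCE : ∀ q ∈ C, q ∈ E → q ∈ D) :
    cutMap η hC hD h ≫ cutMap θ hD hE h' = cutMap (η ≫ θ) hC hE h'' :=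
  cut_hom_ext fun q hqC hqE => by
    simp [cutMap_app _ _ hqC hqE, cutMap_app _ _ hqC (hCE q hqC hqE),
      cutMap_app _ _ (hCE q hqC hqE) hqE]

lemma cutMap_add (η η' : M ⟶ N) (h : CutCompatible C D) :
    cutMap (η + η') hC hD h = cutMap η hC hD h + cutMap η' hC hD h :=
  cut_hom_ext fun q hqC hqD => by simp [cutMap_app _ _ hqC hqD]

lemma cutMap_smul (r : k) (η : M ⟶ N) (h : CutCompatible C D) :
    cutMap (r • η) hC hD h = r • cutMap η hC hD h :=
  cut_hom_ext fun q hqC hqD => by simp [cutMap_app _ _ hqC hqD]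

lemma CutCompatible.refl (C : Set P) : CutCompatible C C := fun _ _ _ hp hq => by tauto

lemma isZero_cut (h : C = ∅) : IsZero (cut M C hC) :=
  (IsZero.iff_id_eq_zero _).2 (cut_hom_ext fun q hq _ => by simp [h] at hq)

variable (M) in
/-- Truncating to the whole poset does nothing. -/
def cutUniv : cut M Set.univ Set.ordConnected_univ ≅ M :=
  NatIso.ofComponents (fun _ => cutIso M _ trivial) (fun f => by
    simp [cut_map f (Set.mem_univ _) (Set.mem_univ _)])

open Classical in
variable (M) in
/-- Truncations to singletons only depend on the value at the point. -/
def cutSingleton (p : P) : cut M {p} Set.ordConnected_singleton ≅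
    cut ((Functor.const P).obj (M.obj p)) {p} Set.ordConnected_singleton :=
  NatIso.ofComponents (fun q => if h : q = p then
      cutIso M Set.ordConnected_singleton (C := {p}) h ≪≫ M.mapIso (eqToIso h) ≪≫
        (cutIso ((Functor.const P).obj (M.obj p)) Set.ordConnected_singleton (C := {p}) h).symm
    else (isZero_cut_obj M Set.ordConnected_singleton (C := {p}) h).iso
      (isZero_cut_obj _ Set.ordConnected_singleton (C := {p}) h)) (fun {q r} f => by
      by_cases hq : q = p
      · by_cases hr : r = p
        · subst hq hr
          obtain rfl : f = 𝟙 _ := Subsingleton.elim _ _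
          rw [CategoryTheory.Functor.map_id, CategoryTheory.Functor.map_id, Category.id_comp,
            Category.comp_id]
        · exact (isZero_cut_obj _ Set.ordConnected_singleton (C := {p}) hr).eq_of_tgt _ _
      · exact (isZero_cut_obj _ Set.ordConnected_singleton (C := {p}) hq).eq_of_src _ _)

/-- Evaluation commutes with homology, and a functor is zero when all its values are. -/
lemma shortExact_of_eval (T : ShortComplex (Rep k P))
    (h : ∀ p, (T.map ((evaluation P (ModuleCat.{w} k)).obj p)).ShortExact) : T.ShortExact where
  mono_f := by
    have : ∀ p, Mono (T.f.app p) := fun p => (h p).mono_f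
    exact NatTrans.mono_of_mono_app _
  epi_g := by
    have : ∀ p, Epi (T.g.app p) := fun p => (h p).epi_g
    exact NatTrans.epi_of_epi_app _
  exact := by
    rw [ShortComplex.exact_iff_isZero_homology, Functor.isZero_iff]
    intro p
    exact ((ShortComplex.exact_iff_isZero_homology _).1 (h p).exact).of_iso
      (T.mapHomologyIso ((evaluation P (ModuleCat.{w} k)).obj p)).symm

section Extension

lemma CutCompatible.of_upper (hCD : C ⊆ D) (h : ∀ ⦃p q⦄, p ≤ q → p ∈ C → q ∈ D → q ∈ C) :
    CutCompatible C D := fun _ _ hpq hp hq => ⟨fun _ => hCD hp, fun _ => h hpq hp hq⟩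

lemma CutCompatible.of_lower (h : ∀ ⦃p q⦄, p ≤ q → p ∈ C → q ∈ D → q ∈ C) :
    CutCompatible D (D \ C) := fun _ _ hpq hp hq =>
  ⟨fun _ => ⟨hp, fun h' => hq.2 (h hpq h' hq.1)⟩, fun _ => hq.1⟩

/-- The extension of truncations given by an upper subset `C` of `D`. -/
def cutShortComplex (M : Rep k P) (hC : C.OrdConnected) (hD : D.OrdConnected)
    (hDC : (D \ C).OrdConnected) (hCD : C ⊆ D)
    (h : ∀ ⦃p q⦄, p ≤ q → p ∈ C → q ∈ D → q ∈ C) : ShortComplex (Rep k P) :=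
  .mk (cutMap (𝟙 M) hC hD (.of_upper hCD h)) (cutMap (𝟙 M) hD hDC (.of_lower h))
    (cut_hom_ext fun _ hq hq' => (hq'.2 hq).elim)

/-- At each point one outer term vanishes and the map between the other two terms is an isomorphism.
-/
lemma cutShortComplex_shortExact (M : Rep k P) (hC : C.OrdConnected) (hD : D.OrdConnected)
    (hDC : (D \ C).OrdConnected) (hCD : C ⊆ D)
    (h : ∀ ⦃p q⦄, p ≤ q → p ∈ C → q ∈ D → q ∈ C) :
    (cutShortComplex M hC hD hDC hCD h).ShortExact := by
  refine shortExact_of_eval _ fun q => ?_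
  set T := (cutShortComplex M hC hD hDC hCD h).map ((evaluation P (ModuleCat.{w} k)).obj q)
  by_cases hq : q ∈ C
  · have h₃ : IsZero T.X₃ := isZero_cut_obj M hDC (fun h' => h'.2 hq)
    have : IsIso T.f := by
      change IsIso ((cutMap (𝟙 M) hC hD (.of_upper hCD h)).app q)
      rw [cutMap_app _ _ hq (hCD hq)]
      infer_instance
    exact { exact := (T.exact_iff_epi (h₃.eq_of_tgt _ _)).2 inferInstance
            mono_f := inferInstance
            epi_g := ⟨fun _ _ _ => h₃.eq_of_src _ _⟩ }
  · have h₁ : IsZero T.X₁ := isZero_cut_obj M hC hq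
    have : IsIso T.g := by
      change IsIso ((cutMap (𝟙 M) hD hDC (.of_lower h)).app q)
      by_cases hqD : q ∈ D
      · rw [cutMap_app _ _ hqD (show q ∈ D \ C from ⟨hqD, hq⟩)]
        infer_instance
      · exact (isZero_cut_obj M hD hqD).isIso
          (isZero_cut_obj M hDC fun h' : q ∈ D \ C => hqD h'.1) _
    exact { exact := (T.exact_iff_mono (h₁.eq_of_src _ _)).2 inferInstance
            mono_f := ⟨fun _ _ _ => h₁.eq_of_tgt _ _⟩
            epi_g := inferInstance }

end Extension

section Devissage

lemma ordConnected_diff_singleton_of_maximal (hC : C.OrdConnected) {p : P}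
    (hp : Maximal (· ∈ C) p) : (C \ {p}).OrdConnected where
  out' _ hx _ hy _ hz := ⟨hC.out hx.1 hy.1 hz, fun h => hy.2
    (le_antisymm (hp.2 hy.1 ((Set.mem_singleton_iff.1 h).symm ▸ hz.2))
      ((Set.mem_singleton_iff.1 h).symm ▸ hz.2))⟩

variable {S : ObjectProperty (Rep k P)}

/-- The extension of truncations given by a maximal element of an order convex subset. -/
lemma exists_shortExact_of_maximal (M : Rep k P) (hC : C.OrdConnected) {p : P}
    (hp : Maximal (· ∈ C) p) : ∃ T : ShortComplex (Rep k P), T.ShortExact ∧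
      T.X₁ = cut M {p} Set.ordConnected_singleton ∧ T.X₂ = cut M C hC ∧
      T.X₃ = cut M (C \ {p}) (ordConnected_diff_singleton_of_maximal hC hp) :=
  ⟨_, cutShortComplex_shortExact M Set.ordConnected_singleton hC
    (ordConnected_diff_singleton_of_maximal hC hp)
    (Set.singleton_subset_iff.2 hp.1) (fun q r hqr hq hr => by
      obtain rfl := Set.mem_singleton_iff.1 hq
      exact Set.mem_singleton_iff.2 (le_antisymm (hp.2 hr hqr) hqr)), rfl, rfl, rfl⟩

variable [Finite P]

/-- Remove a maximal point of `C`: it carries a subobject, the rest is the quotient, and the rest is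
still convex. -/
lemma IsThick.cut_mem (hS : IsThick S) (hC : C.OrdConnected)
    (h : ∀ p ∈ C, S (cut M {p} Set.ordConnected_singleton)) : S (cut M C hC) := by
  induction hn : C.ncard generalizing C with
  | zero =>
    exact hS.zero _ (isZero_cut ((Set.ncard_eq_zero C.toFinite).1 hn))
  | succ n ih =>
    obtain ⟨p, hp⟩ := C.toFinite.exists_maximal
      ((Set.ncard_pos C.toFinite).1 (by lia))
    obtain ⟨T, hT, h₁, h₂, h₃⟩ := exists_shortExact_of_maximal M hC hp
    rw [← h₂]
    refine hS.middle hT (h₁ ▸ h p hp.1) (h₃ ▸ ih _ (fun q hq => h q hq.1) ?_)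
    rw [Set.ncard_sdiff_singleton_of_mem hp.1, hn, Nat.add_sub_cancel]

/-- This inverts `cut_mem`. Maximal points other than `p` are stripped from `C`; once `p` itself is
maximal, the quotient on `C \ {p}` is built from known singletons, so the subobject at `p` is in
`S`. -/
lemma IsThick.cut_singleton_mem (hS : IsThick S) (hC : C.OrdConnected) {p : P} (hpC : p ∈ C)
    (h : S (cut M C hC))
    (h' : ∀ q ∈ C, q ≠ p → S (cut M {q} Set.ordConnected_singleton)) :
    S (cut M {p} Set.ordConnected_singleton) := by
  induction hn : C.ncard generalizing C with
  | zero =>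
    rw [(Set.ncard_eq_zero C.toFinite).1 hn] at hpC
    exact hpC.elim
  | succ n ih =>
    obtain ⟨m, hm⟩ := C.toFinite.exists_maximal ⟨p, hpC⟩
    obtain ⟨T, hT, h₁, h₂, h₃⟩ := exists_shortExact_of_maximal M hC hm
    by_cases hmp : m = p
    · subst hmp
      rw [← h₁]
      exact hS.left hT (h₂ ▸ h) (h₃ ▸ hS.cut_mem _ fun q hq => h' q hq.1 hq.2)
    · refine ih (ordConnected_diff_singleton_of_maximal hC hm) ⟨hpC, fun h => hmp h.symm⟩ ?_
        (fun q hq => h' q hq.1) ?_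
      · rw [← h₃]
        exact hS.right hT (h₁ ▸ h' m hm.1 hmp) (h₂ ▸ h)
      · rw [Set.ncard_sdiff_singleton_of_mem hm.1, hn, Nat.add_sub_cancel]

/-- The finitely generated projective modules. -/
def FinProj (N : ModuleCat.{w} k) : Prop := Module.Finite k N ∧ Module.Projective k N

/-- A thick class of representations contains all pointwise finitely generated projective
representations as soon as it contains the truncations of the constant ones to a family of
order convex subsets which is unitriangular for some order. -/
lemma IsThick.mem_of_forall_finProj (hS : IsThick S) {Q : Type*} [PartialOrder Q] [Finite Q]
    (f : P → Q) (hf : Function.Injective f) (C : P → Set P) (hC : ∀ p, (C p).OrdConnected)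
    (hmem : ∀ p, p ∈ C p) (hle : ∀ p, ∀ q ∈ C p, f q ≤ f p)
    (h : ∀ p N, FinProj N → S (cut ((Functor.const P).obj N) (C p) (hC p)))
    (M : Rep k P) (hM : ∀ p, FinProj (M.obj p)) : S M := by
  -- Triangular inversion: the points of `C p` other than `p` have strictly smaller image under `f`,
  -- so their singletons are known by induction.
  have key : ∀ p N, FinProj N →
      S (cut ((Functor.const P).obj N) {p} Set.ordConnected_singleton) := by
    intro p
    induction hx : f p using (wellFounded_lt (α := Q)).induction generalizing p with
    | _ x ih =>
      intro N hN
      refine hS.cut_singleton_mem (hC p) (hmem p) (h p N hN) fun q hq hqp => ?_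
      exact ih (f q) (hx ▸ lt_of_le_of_ne (hle p q hq) (hf.ne hqp)) q rfl N hN
  exact hS.iso (cutUniv M) (hS.cut_mem _ fun p _ =>
    hS.iso (cutSingleton M p).symm (key p _ (hM p)))

end Devissage

end Cut

/-! ### Finitely generated projective modules and representations -/

section FinProj

variable {k : Type w} [CommRing k]

/-- The identity `∑ a i ≫ b i = 𝟙` expresses being a direct summand of `⨁ Z i` without naming a
biproduct, so additive functors transport it directly. Summands are handled in this form from here
on. -/
lemma FinProj.of_sum {ι : Type*} [Fintype ι] {N : ModuleCat.{w} k} (Z : ι → ModuleCat.{w} k)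
    (hZ : ∀ i, FinProj (Z i)) (a : ∀ i, N ⟶ Z i) (b : ∀ i, Z i ⟶ N)
    (h : ∑ i, a i ≫ b i = 𝟙 N) : FinProj N := by
  have := fun i => (hZ i).1
  have := fun i => (hZ i).2
  classical
  let α : N →ₗ[k] ∀ i, Z i := LinearMap.pi fun i => (a i).hom
  let β : (∀ i, Z i) →ₗ[k] N := ∑ i, (b i).hom ∘ₗ LinearMap.proj i
  have hβ : β ∘ₗ α = LinearMap.id := by
    have e := congrArg ModuleCat.Hom.hom h
    rw [ModuleCat.hom_sum] at e
    ext x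
    simpa [α, β] using congrArg (fun φ => φ x) e
  refine ⟨Module.Finite.of_surjective β fun x => ⟨α x, congrArg (fun φ => φ x) hβ⟩, ?_⟩
  have : Module.Projective k (∀ i, Z i) := .of_equiv DFinsupp.linearEquivFunOnFintype
  exact Module.Projective.of_split α β hβ

lemma FinProj.of_isZero {N : ModuleCat.{w} k} (h : IsZero N) : FinProj N :=
  .of_sum (ι := Fin 0) (fun _ => N) (fun i => i.elim0) (fun i => i.elim0) (fun i => i.elim0)
    (h.eq_of_src _ _)

lemma FinProj.of_iso {N N' : ModuleCat.{w} k} (e : N ≅ N') (h : FinProj N) : FinProj N' :=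
  .of_sum (ι := Fin 1) (fun _ => N) (fun _ => h) (fun _ => e.inv) (fun _ => e.hom) (by simp)

lemma FinProj.self : FinProj (ModuleCat.of k k) :=
  ⟨inferInstanceAs (Module.Finite k k), inferInstanceAs (Module.Projective k k)⟩

lemma FinProj.exists_sum_eq_id {N : ModuleCat.{w} k} (hN : FinProj N) :
    ∃ (n : ℕ) (a : Fin n → (N ⟶ ModuleCat.of k k)) (b : Fin n → (ModuleCat.of k k ⟶ N)),
      ∑ i, a i ≫ b i = 𝟙 N := by
  have := hN.1
  have := hN.2
  obtain ⟨n, f, g, -, -, h⟩ := Module.Finite.exists_comp_eq_id_of_projective k N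
  refine ⟨n, fun i => ModuleCat.ofHom (LinearMap.proj i ∘ₗ g),
    fun i => ModuleCat.ofHom (f ∘ₗ LinearMap.single k (fun _ => k) i), ?_⟩
  refine ModuleCat.hom_ext ?_
  rw [ModuleCat.hom_sum]
  refine LinearMap.ext fun x => ?_
  have e : f (∑ i, Pi.single i (g x i)) = x := by
    rw [Finset.univ_sum_single]
    exact congrArg (fun φ => φ x) h
  rw [map_sum] at e
  simpa using e

lemma FinProj.projective {N : ModuleCat.{w} k} (hN : FinProj N) : Projective N :=
  (IsProjective.iff_projective N).1 hN.2

end FinProj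

section Ici

variable {k : Type w} [CommRing k] {P : Type t} [PartialOrder P] {M : Rep k P}

open Classical in
/-- A constant representation truncated to the elements above `p` is freely generated by its
value at `p`. -/
def cutDesc {p : P} {N : ModuleCat.{w} k} (h : N ⟶ M.obj p) :
    cut ((Functor.const P).obj N) (Set.Ici p) Set.ordConnected_Ici ⟶ M where
  app q := if hq : q ∈ Set.Ici p then (cutIso _ _ hq).hom ≫ h ≫ M.map (homOfLE hq) else 0
  naturality q r f := by
    by_cases hq : q ∈ Set.Ici p
    · have hr : r ∈ Set.Ici p := le_trans hq (leOfHom f)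
      rw [dif_pos hq, dif_pos hr, cut_map _ hq hr]
      simp only [Category.assoc, ← Functor.map_comp, Functor.const_obj_map,
        Iso.inv_hom_id_assoc]
      rfl
    · exact (isZero_cut_obj _ Set.ordConnected_Ici hq).eq_of_src _ _

lemma cutDesc_app {p : P} {N : ModuleCat.{w} k} (h : N ⟶ M.obj p) {q : P} (hq : q ∈ Set.Ici p) :
    (cutDesc h).app q = (cutIso _ _ hq).hom ≫ h ≫ M.map (homOfLE hq) := dif_pos hq

lemma cutIci_hom_ext {p : P} {N : ModuleCat.{w} k}
    {f g : cut ((Functor.const P).obj N) (Set.Ici p) Set.ordConnected_Ici ⟶ M}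
    (h : f.app p = g.app p) : f = g := by
  refine NatTrans.ext (funext fun q => ?_)
  by_cases hq : q ∈ Set.Ici p
  · have : IsIso ((cut ((Functor.const P).obj N) (Set.Ici p) Set.ordConnected_Ici).map
        (homOfLE hq)) := by
      rw [cut_map _ Set.self_mem_Ici hq]
      exact inferInstanceAs (IsIso (_ ≫ 𝟙 _ ≫ _))
    rw [← cancel_epi ((cut ((Functor.const P).obj N) (Set.Ici p) Set.ordConnected_Ici).map
        (homOfLE hq)), f.naturality, g.naturality, h]
  · exact (isZero_cut_obj _ Set.ordConnected_Ici hq).eq_of_src _ _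

/-- Morphisms to `M` are the same as morphisms `N ⟶ M.obj p`, and epimorphisms of representations
are pointwise. -/
lemma projective_cut_Ici (p : P) (N : ModuleCat.{w} k) [Projective N] :
    Projective (cut ((Functor.const P).obj N) (Set.Ici p) Set.ordConnected_Ici) where
  factors {A B} f e _ := by
    have hp : p ∈ Set.Ici p := Set.self_mem_Ici
    refine ⟨cutDesc (Projective.factorThru ((cutIso ((Functor.const P).obj N)
      Set.ordConnected_Ici hp).inv ≫ f.app p)
      (e.app p)), cutIci_hom_ext ?_⟩
    rw [NatTrans.comp_app, cutDesc_app _ hp]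
    obtain h : homOfLE hp = 𝟙 p := Subsingleton.elim _ _
    simp [h]

variable (k) in
/-- The functor `P_x` as a truncated constant functor. -/
def projRepIso (x : P) : projRep k x ≅
    cut ((Functor.const P).obj (ModuleCat.of k k)) (Set.Ici x) Set.ordConnected_Ici :=
  NatIso.ofComponents
    (fun z => (Finsupp.linearEquivFunOnFinite k k (PLift (x ≤ z))).toModuleIso) (fun {y z} f => by
      by_cases hy : y ∈ Set.Ici x
      · have hz : z ∈ Set.Ici x := le_trans hy (leOfHom f)
        rw [cut_map _ hy hz]
        refine ModuleCat.hom_ext (Finsupp.lhom_ext fun hy' r => ?_)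
        funext hz'
        change Finsupp.mapDomain (fun h => PLift.up (h.down.trans (leOfHom f)))
          (Finsupp.single hy' r) hz' = Finsupp.single hy' r _
        rw [Finsupp.mapDomain_single]
        exact Finsupp.single_eq_same.trans Finsupp.single_eq_same.symm
      · have : IsEmpty (PLift (x ≤ y)) := ⟨fun h => hy h.down⟩
        exact (ModuleCat.isZero_of_subsingleton (ModuleCat.of k (PLift (x ≤ y) →₀ k))).eq_of_src
          _ _)

end Ici

section FinGen

variable {k : Type w} [CommRing k] {P : Type t} [PartialOrder P]

/-- A jointly epimorphic finite family suffices, over any finite index type. -/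
lemma isFinGen_of_cancel_zero {ι : Type*} [Finite ι] {M : Rep k P} (x : ι → P)
    (g : ∀ i, projRep k (x i) ⟶ M)
    (h : ∀ (N : Rep k P) (φ : M ⟶ N), (∀ i, g i ≫ φ = 0) → φ = 0) : IsFinGen M := by
  let e := (Finite.equivFin ι).symm
  refine ⟨_, fun i => x (e i), biproduct.desc fun i => g (e i),
    Preadditive.epi_of_cancel_zero _ fun φ hφ => h _ φ fun i => ?_⟩
  obtain ⟨j, rfl⟩ := e.surjective i
  rw [← biproduct.ι_desc (fun i => g (e i)) j, Category.assoc, hφ, comp_zero]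

variable (k P) in
/-- The finitely generated projective representations. -/
def finGenProj : ObjectProperty (Rep k P) := fun M => Projective M ∧ IsFinGen M

instance : (finGenProj k P).IsClosedUnderIsomorphisms where
  of_iso := by
    rintro M N e ⟨h, n, x, f, hf⟩
    exact ⟨Projective.of_iso e h, n, x, f ≫ e.hom, inferInstance⟩

instance : (finGenProj k P).ContainsZero where
  exists_zero := ⟨_, isZero_zero _, inferInstance, 0, fun i => i.elim0, 0,
    ⟨fun _ _ _ => (isZero_zero _).eq_of_src _ _⟩⟩

lemma finGenProj_biprod {M N : Rep k P} (hM : finGenProj k P M) (hN : finGenProj k P N) :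
    finGenProj k P (M ⊞ N) := by
  obtain ⟨_, n, x, f, _⟩ := hM
  obtain ⟨_, m, y, g, _⟩ := hN
  refine ⟨inferInstance, isFinGen_of_cancel_zero (ι := Fin n ⊕ Fin m) (Sum.elim x y)
    (fun i => match i with
    | .inl i => biproduct.ι (fun i => projRep k (x i)) i ≫ f ≫ biprod.inl
    | .inr i => biproduct.ι (fun i => projRep k (y i)) i ≫ g ≫ biprod.inr) fun L h hh => ?_⟩
  refine biprod.hom_ext' _ _ ?_ ?_
  · rw [← cancel_epi f]
    refine biproduct.hom_ext' _ _ fun i => ?_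
    have : (biproduct.ι (fun i => projRep k (x i)) i ≫ f ≫ biprod.inl) ≫ h = 0 := hh (.inl i)
    rw [Category.assoc, Category.assoc] at this
    rw [this, comp_zero, comp_zero, comp_zero]
  · rw [← cancel_epi g]
    refine biproduct.hom_ext' _ _ fun i => ?_
    have : (biproduct.ι (fun i => projRep k (y i)) i ≫ g ≫ biprod.inr) ≫ h = 0 := hh (.inr i)
    rw [Category.assoc, Category.assoc] at this
    rw [this, comp_zero, comp_zero, comp_zero]

lemma finProj_projRep (x p : P) : FinProj ((projRep k x).obj p) :=
  ⟨inferInstanceAs (Module.Finite k (PLift (x ≤ p) →₀ k)),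
    inferInstanceAs (Module.Projective k (PLift (x ≤ p) →₀ k))⟩

lemma finProj_of_sum {ι : Type*} [Fintype ι] {M : Rep k P} (Z : ι → Rep k P)
    (hZ : ∀ i p, FinProj ((Z i).obj p)) (a : ∀ i, M ⟶ Z i) (b : ∀ i, Z i ⟶ M)
    (h : ∑ i, a i ≫ b i = 𝟙 M) (p : P) : FinProj (M.obj p) :=
  .of_sum (fun i => (Z i).obj p) (fun i => hZ i p) (fun i => (a i).app p) (fun i => (b i).app p)
    (by simpa using congrArg (fun φ => NatTrans.app φ p) h)

/-- The presenting epimorphism splits, so `M` is a summand of a finite sum of `P_x`. -/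
lemma finProj_of_finGenProj {M : Rep k P} (h : finGenProj k P M) (p : P) :
    FinProj (M.obj p) := by
  obtain ⟨_, n, x, f, _⟩ := h
  refine finProj_of_sum (fun i => projRep k (x i)) (fun i => finProj_projRep (x i))
    (fun i => Projective.factorThru (𝟙 M) f ≫ biproduct.π (fun i => projRep k (x i)) i) 
    (fun i => biproduct.ι (fun i => projRep k (x i)) i ≫ f) ?_ p
  have h : ∑ i, biproduct.π (fun i => projRep k (x i)) i ≫ biproduct.ι (fun i => projRep k (x i)) i
      = 𝟙 _ := biproduct.total
  calc _ = Projective.factorThru (𝟙 M) f ≫ (∑ i, biproduct.π (fun i => projRep k (x i)) i ≫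
        biproduct.ι (fun i => projRep k (x i)) i) ≫ f := by
        simp only [Preadditive.sum_comp, Preadditive.comp_sum, Category.assoc]
    _ = _ := by rw [h, Category.id_comp, Projective.factorThru_comp]

lemma sum_cutMap_const {n : ℕ} {N : ModuleCat.{w} k} {N' : Fin n → ModuleCat.{w} k}
    (a : ∀ i, N ⟶ N' i) (b : ∀ i, N' i ⟶ N) (h : ∑ i, a i ≫ b i = 𝟙 N) {C : Set P}
    (hC : C.OrdConnected) :
    ∑ i, cutMap ((Functor.const P).map (a i)) hC hC (.refl C) ≫
      cutMap ((Functor.const P).map (b i)) hC hC (.refl C) = 𝟙 _ := by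
  refine cut_hom_ext fun q hq _ => ?_
  simp only [NatTrans.app_sum, NatTrans.comp_app, cutMap_app _ _ hq hq, Category.assoc,
    Iso.inv_hom_id_assoc]
  have e := congrArg (fun φ => (cutIso ((Functor.const P).obj N) hC hq).hom ≫ φ ≫
    (cutIso ((Functor.const P).obj N) hC hq).inv) h
  simpa [Preadditive.sum_comp, Preadditive.comp_sum] using e

lemma finGenProj_cut_Ici {p : P} {N : ModuleCat.{w} k} (hN : FinProj N) :
    finGenProj k P (cut ((Functor.const P).obj N) (Set.Ici p) Set.ordConnected_Ici) := by
  have := hN.projective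
  obtain ⟨n, a, b, h⟩ := hN.exists_sum_eq_id
  refine ⟨projective_cut_Ici p N, isFinGen_of_cancel_zero (fun _ : Fin n => p) (fun i =>
    (projRepIso k p).hom ≫ cutMap ((Functor.const P).map (b i)) _ _ (.refl _)) fun L φ hφ => ?_⟩
  rw [← Category.id_comp φ, ← sum_cutMap_const a b h, Preadditive.sum_comp]
  refine Finset.sum_eq_zero fun i _ => ?_
  have := (projRepIso k p).inv ≫= hφ i
  rw [Category.assoc, Iso.inv_hom_id_assoc, comp_zero] at this
  rw [Category.assoc, this, comp_zero]

end FinGen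

lemma biproduct_sum_eq_id {C : Type*} [Category* C] [Preadditive C] {ι : Type*} [Fintype ι]
    (f : ι → C) [HasBiproduct f] : ∑ i, biproduct.π f i ≫ biproduct.ι f i = 𝟙 (⨁ f) := by
  classical
  refine biproduct.hom_ext _ _ fun j => ?_
  simp [Preadditive.sum_comp, biproduct.ι_π, comp_dite]

section AddClosure

variable {C : Type*} [Category* C] [HasZeroObject C] [HasShift C ℤ] [Preadditive C]
  [∀ n : ℤ, (shiftFunctor C n).Additive] [Pretriangulated C]

lemma addClosure_iff (T K : C) : addClosure T K ↔
    ∃ (n : ℕ) (a : Fin n → (K ⟶ T)) (b : Fin n → (T ⟶ K)), ∑ i, a i ≫ b i = 𝟙 K := by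
  constructor
  · rintro ⟨n, ⟨r⟩⟩
    refine ⟨n, fun i => r.i ≫ biproduct.π _ i, fun i => biproduct.ι (fun _ : Fin n => T) i ≫ r.r, ?_⟩
    have h : ∑ i, biproduct.π (fun _ : Fin n => T) i ≫ biproduct.ι (fun _ : Fin n => T) i = 𝟙 _ :=
      biproduct.total
    calc _ = r.i ≫ (∑ i, biproduct.π (fun _ : Fin n => T) i ≫
          biproduct.ι (fun _ : Fin n => T) i) ≫ r.r := by
          simp only [Preadditive.sum_comp, Preadditive.comp_sum, Category.assoc]
      _ = _ := by rw [h, Category.id_comp, r.retract]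
  · rintro ⟨n, a, b, h⟩
    exact ⟨n, ⟨⟨biproduct.lift a, biproduct.desc b, by rw [biproduct.lift_desc, h]⟩⟩⟩

end AddClosure

/-! ### Degree zero objects of the bounded derived category -/

section Bounded

open DerivedCategory

variable {A : Type*} [Category* A] [Abelian A] [HasDerivedCategory.{t} A]

variable (A) in
/-- The embedding of an abelian category in its bounded derived category. -/
def toBoundedFunctor : A ⥤ DerivedCategory.Bounded A :=
  ObjectProperty.lift _ (singleFunctor A 0) fun M => (toBounded M).property

variable (A) in
/-- The embedding in the bounded derived category is fully faithful. -/
def fullyFaithfulToBounded : (toBoundedFunctor A).FullyFaithful where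
  preimage f := (Functor.FullyFaithful.ofFullyFaithful (singleFunctor A 0)).preimage f.hom
  map_preimage f := ObjectProperty.hom_ext _
    ((Functor.FullyFaithful.ofFullyFaithful (singleFunctor A 0)).map_preimage f.hom)
  preimage_map f :=
    (Functor.FullyFaithful.ofFullyFaithful (singleFunctor A 0)).preimage_map f

instance : (toBoundedFunctor A).Additive where
  map_add := ObjectProperty.hom_ext _ ((singleFunctor A 0).map_add)

instance {R : Type*} [Ring R] [Linear R A] : (toBoundedFunctor A).Linear R where
  map_smul f r := ObjectProperty.hom_ext _ (Functor.Linear.map_smul (F := singleFunctor A 0) f r)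

/-- Membership can be tested in the whole derived category, where the dévissage lemmas are stated.
-/
lemma map_ι_iff (R : ObjectProperty (DerivedCategory.Bounded A)) [R.IsClosedUnderIsomorphisms]
    (K : DerivedCategory.Bounded A) : R.map Bounded.ι K.obj ↔ R K := by
  constructor
  · rintro ⟨K', h, ⟨e⟩⟩
    exact R.prop_of_iso (ObjectProperty.fullyFaithfulι _ |>.preimageIso e) h
  · intro h
    exact ⟨K, h, ⟨Iso.refl _⟩⟩

/-- The objects of `add T`, for `T` in the abelian category, are concentrated in degree `0`. -/
lemma exists_iso_of_addClosure {T : A} {K : DerivedCategory.Bounded A}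
    (hK : addClosure (toBounded T) K) : ∃ (M : A) (n : ℕ) (a : Fin n → (M ⟶ T))
      (b : Fin n → (T ⟶ M)), Nonempty (K ≅ toBounded M) ∧ ∑ i, a i ≫ b i = 𝟙 M := by
  rw [addClosure_iff] at hK
  obtain ⟨n, a, b, h⟩ := hK
  have h' : ∑ i, (a i).hom ≫ (b i).hom = 𝟙 K.obj := by
    have := congrArg Bounded.ι.map h
    rw [Functor.map_sum] at this
    exact this
  -- The identity of `K` factors through copies of `T`, so the homology of `K` vanishes wherever
  -- that of `T` does.
  have hz : ∀ i, IsZero ((homologyFunctor A i).obj (toBounded T).obj) →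
      IsZero ((homologyFunctor A i).obj K.obj) := fun i hi => by
    rw [IsZero.iff_id_eq_zero, ← CategoryTheory.Functor.map_id, ← h', Functor.map_sum]
    refine Finset.sum_eq_zero fun j _ => ?_
    rw [Functor.map_comp, hi.eq_zero_of_tgt ((homologyFunctor A i).map (a j).hom), zero_comp]
  have : K.obj.IsGE 0 := by
    rw [isGE_iff]
    exact fun i hi => hz i (isZero_of_isGE ((singleFunctor A 0).obj T) 0 i hi)
  have : K.obj.IsLE 0 := by
    rw [isLE_iff]
    exact fun i hi => hz i (isZero_of_isLE ((singleFunctor A 0).obj T) 0 i hi)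
  obtain ⟨M, ⟨e⟩⟩ := exists_iso_singleFunctor_obj_of_isGE_of_isLE K.obj 0
  let e' : K ≅ toBounded M := ObjectProperty.fullyFaithfulι _ |>.preimageIso e
  refine ⟨M, n, fun i => (fullyFaithfulToBounded A).preimage (e'.inv ≫ a i),
    fun i => (fullyFaithfulToBounded A).preimage (b i ≫ e'.hom), ⟨e'⟩,
    (fullyFaithfulToBounded A).map_injective ?_⟩
  have key : ∑ i, (e'.inv ≫ a i) ≫ (b i ≫ e'.hom) = 𝟙 (toBounded M) := by
    calc _ = e'.inv ≫ (∑ i, a i ≫ b i) ≫ e'.hom := by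
          simp only [Preadditive.sum_comp, Preadditive.comp_sum, Category.assoc]
      _ = _ := by rw [h, Category.id_comp, Iso.inv_hom_id]
  rw [Functor.map_sum, CategoryTheory.Functor.map_id]
  simp only [Functor.map_comp, Functor.FullyFaithful.map_preimage]
  exact key

end Bounded

/-! ### Perfect complexes over a finite poset -/

section Perfect

variable {k : Type w} [CommRing k] {P : Type u} [PartialOrder P]

section

variable [HasDerivedCategory.{t} (Rep k P)]

instance : (boundedResolved (finGenProj k P)).IsTriangulated :=
  boundedResolved_isTriangulated _ (fun _ h => h.1) fun _ _ => finGenProj_biprod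

instance : (perfect (k := k) (P := P)).IsTriangulated :=
  inferInstanceAs ((boundedResolved (finGenProj k P)).inverseImage
    DerivedCategory.Bounded.ι).IsTriangulated

instance : (perfect (k := k) (P := P)).IsClosedUnderIsomorphisms :=
  inferInstanceAs ((boundedResolved (finGenProj k P)).inverseImage
    DerivedCategory.Bounded.ι).IsClosedUnderIsomorphisms

/-- Over a finite poset, pointwise finitely generated projective representations are perfect. -/
lemma perfect_toBounded [Finite P] (M : Rep k P) (hM : ∀ p, FinProj (M.obj p)) :
    perfect (toBounded M) :=
  -- The triangular family is `Set.Ici p` for the reversed order on `P`; its truncated constants are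
  -- finitely generated projectives.
  (isThick_single (boundedResolved (finGenProj k P))).mem_of_forall_finProj OrderDual.toDual
    OrderDual.toDual.injective (fun p => Set.Ici p) (fun _ => Set.ordConnected_Ici)
    (fun _ => Set.self_mem_Ici) (fun _ _ h => h)
    (fun _ _ hN => boundedResolved_single (finGenProj_cut_Ici hN)) M hM

/-- Objects of `add T` are representations in degree `0`, still pointwise finitely generated
projective; hence no closure of perfect complexes under summands is required. -/
lemma addClosure_le_perfect [Finite P] (T : Rep k P) (hT : ∀ p, FinProj (T.obj p)) :
    addClosure (toBounded T) ≤ perfect (k := k) (P := P) := by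
  intro K hK
  obtain ⟨M, n, a, b, ⟨e⟩, h⟩ := exists_iso_of_addClosure hK
  exact ObjectProperty.prop_of_iso _ e.symm
    (perfect_toBounded M (finProj_of_sum (fun _ => T) (fun _ => hT) a b h))

end

end Perfect

/-! ### The summands of `T` and generation -/

section Tilting

variable {X : Type u} {Y : Type v} [PartialOrder X] [PartialOrder Y] (F : Y →o LowerSet X)

/-- The support of the summand of the tilting complex indexed by `p`. -/
def tiltSet {F : Y →o LowerSet X} (p : Gamma F) : Set (Gamma F) :=
  {q | p.1.1 ≤ q.1.1 ∧ q.1.2 ≤ p.1.2}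

lemma tiltSet_ordConnected {F : Y →o LowerSet X} (p : Gamma F) : (tiltSet p).OrdConnected where
  out' _ hx _ hy _ hz := ⟨hx.1.trans hz.1.1, hz.2.2.trans hy.2⟩

variable (k : Type w) [CommRing k]

variable {F} in
/-- The summand of the tilting complex indexed by `p`. -/
abbrev tiltSummand (p : Gamma F) : Rep k (Gamma F) :=
  cut ((Functor.const (Gamma F)).obj (ModuleCat.of k k)) (tiltSet p) (tiltSet_ordConnected p)

lemma mapDomain_plift {p q : Prop} (h : p → q) (s : PLift p →₀ k) (hp : PLift p) (hq : PLift q) :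
    Finsupp.mapDomain (fun x : PLift p => PLift.up (h x.down)) s hq = s hp := by
  have hs : s = Finsupp.single hp (s hp) := by
    ext hp'
    obtain rfl : hp = hp' := Subsingleton.elim _ _
    exact Finsupp.single_eq_same.symm
  rw [hs, Finsupp.mapDomain_single]
  exact Finsupp.single_eq_same.trans Finsupp.single_eq_same.symm

variable {F} in
/-- The values of the summands of the tilting complex. -/
def pushforwardProjEquiv (y : Y) (x : F y) (q : Gamma F) :
    ((pushforward k F y).obj (projRep k x)).obj q ≃ₗ[k]
      (tiltSummand k (⟨(x.1, y), x.2⟩ : Gamma F)).obj q where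
  toFun (s : ∀ h : PLift (q.1.2 ≤ y), PLift (x ≤ baseChange F y q h.down) →₀ k) :=
    show PLift (q ∈ tiltSet (⟨(x.1, y), x.2⟩ : Gamma F)) → k from
      fun h => s ⟨h.down.2⟩ ⟨h.down.1⟩
  map_add' _ _ := rfl
  map_smul' _ _ := rfl
  invFun (s : PLift (q ∈ tiltSet (⟨(x.1, y), x.2⟩ : Gamma F)) → k) :=
    show ∀ h : PLift (q.1.2 ≤ y), PLift (x ≤ baseChange F y q h.down) →₀ k from
      fun h => Finsupp.equivFunOnFinite.symm fun h' => s ⟨h'.down, h.down⟩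
  left_inv _ := funext fun _ => Finsupp.ext fun _ => rfl
  right_inv _ := rfl

variable {F} in
/-- The summands of the tilting complex are truncated constant functors. -/
def pushforwardProjIso (y : Y) (x : F y) : (pushforward k F y).obj (projRep k x) ≅
    tiltSummand k (⟨(x.1, y), x.2⟩ : Gamma F) :=
  NatIso.ofComponents (fun q => (pushforwardProjEquiv k y x q).toModuleIso) (fun {q r} f => by
    by_cases hq : q ∈ tiltSet (⟨(x.1, y), x.2⟩ : Gamma F)
    · by_cases hr : r ∈ tiltSet (⟨(x.1, y), x.2⟩ : Gamma F)
      · rw [cut_map _ hq hr]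
        refine ModuleCat.hom_ext (LinearMap.ext fun s => funext fun h => ?_)
        exact mapDomain_plift k (p := x ≤ baseChange F y q hq.2) (q := x ≤ baseChange F y r hr.2)
          (fun h => le_trans h (leOfHom f).1)
          ((show ∀ h : PLift (q.1.2 ≤ y), PLift (x ≤ baseChange F y q h.down) →₀ k from s) ⟨hq.2⟩)
          ⟨hq.1⟩ ⟨hr.1⟩
      · exact (isZero_cut_obj _ (tiltSet_ordConnected _) hr).eq_of_tgt _ _
    · exact (IsZero.of_iso (isZero_cut_obj ((Functor.const (Gamma F)).obj (ModuleCat.of k k))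
        (tiltSet_ordConnected _) hq) (pushforwardProjEquiv k y x q).toModuleIso).eq_of_src _ _)

variable [Finite X] [Finite Y]

/-- The tilting complex is a direct sum of truncated constant functors. -/
def tiltingRepIso : tiltingRep k F ≅ ⨁ fun p : Gamma F => tiltSummand k p :=
  biproductBiproductIso (fun y : Y => F y)
      (fun (y : Y) (x : F y) => (pushforward k F y).obj (projRep k x)) ≪≫
    biproduct.whiskerEquiv
      (f := fun p : (Σ y : Y, F y) => (pushforward k F p.1).obj (projRep k p.2))
      (g := fun p : Gamma F => tiltSummand k p)
      { toFun := fun p => ⟨(p.2.1, p.1), p.2.2⟩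
        invFun := fun p => ⟨p.1.2, p.1.1, p.2⟩
        left_inv := fun _ => rfl
        right_inv := fun _ => rfl } fun p => (pushforwardProjIso k p.1 p.2).symm

variable {F}

/-- The inclusion of a summand in the tilting complex. -/
def tiltIncl (p : Gamma F) : tiltSummand k p ⟶ tiltingRep k F :=
  biproduct.ι (fun p : Gamma F => tiltSummand k p) p ≫ (tiltingRepIso F k).inv

/-- The projection of the tilting complex to a summand. -/
def tiltProj (p : Gamma F) : tiltingRep k F ⟶ tiltSummand k p :=
  (tiltingRepIso F k).hom ≫ biproduct.π (fun p : Gamma F => tiltSummand k p) p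

lemma tiltIncl_tiltProj_self (p : Gamma F) : tiltIncl k p ≫ tiltProj k p = 𝟙 _ := by
  simp [tiltIncl, tiltProj]

lemma tiltIncl_tiltProj_of_ne {p q : Gamma F} (h : p ≠ q) :
    tiltIncl k p ≫ tiltProj k q = 0 := by
  simp [tiltIncl, tiltProj, biproduct.ι_π_ne _ h]

variable (F) in
lemma sum_tiltProj_tiltIncl [Fintype (Gamma F)] :
    ∑ p : Gamma F, tiltProj k p ≫ tiltIncl k p = 𝟙 (tiltingRep k F) := by
  have h := congrArg (fun φ => (tiltingRepIso F k).hom ≫ φ ≫ (tiltingRepIso F k).inv)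
    (biproduct_sum_eq_id (fun p : Gamma F => tiltSummand k p))
  simpa only [tiltProj, tiltIncl, Preadditive.sum_comp, Preadditive.comp_sum, Category.assoc,
    Category.id_comp, Iso.hom_inv_id] using h

variable (F)

lemma tiltingRep_finProj (p : Gamma F) : FinProj ((tiltingRep k F).obj p) := by
  have := Fintype.ofFinite (Gamma F)
  refine finProj_of_sum (fun q => tiltSummand k q) (fun q r => ?_) _ _
    (sum_tiltProj_tiltIncl F k) p
  by_cases h : r ∈ tiltSet q
  · exact FinProj.self.of_iso (cutIso _ (tiltSet_ordConnected q) h).symm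
  · exact .of_isZero (isZero_cut_obj _ (tiltSet_ordConnected q) h)

variable [HasDerivedCategory.{t} (Rep k (Gamma F))]

/-- `N` is a summand of some `k ^ n`, so the truncated constant `N` is a summand of `n` copies of
`tiltSummand k p`. -/
lemma addClosure_cut_tiltSet (p : Gamma F) {N : ModuleCat.{w} k} (hN : FinProj N) :
    addClosure (toBounded (tiltingRep k F)) (toBounded
      (cut ((Functor.const (Gamma F)).obj N) (tiltSet p) (tiltSet_ordConnected p))) := by
  obtain ⟨n, a, b, h⟩ := hN.exists_sum_eq_id
  let G := toBoundedFunctor (Rep k (Gamma F))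
  rw [addClosure_iff]
  refine ⟨n, fun j => G.map (cutMap ((Functor.const _).map (a j)) _ _ (.refl _) ≫ tiltIncl k p),
    fun j => G.map (tiltProj k p ≫ cutMap ((Functor.const _).map (b j)) _ _ (.refl _)), ?_⟩
  have := congrArg G.map (sum_cutMap_const a b h (tiltSet_ordConnected p))
  rw [Functor.map_sum, CategoryTheory.Functor.map_id] at this
  refine Eq.trans (Finset.sum_congr rfl fun j _ => ?_) this
  refine (G.map_comp _ _).symm.trans (congrArg G.map ?_)
  rw [Category.assoc, ← Category.assoc (tiltIncl k p), tiltIncl_tiltProj_self, Category.id_comp]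

/-- The heart of generation: the subsets `tiltSet p` are triangular for `Xᵒᵖ × Y`, since `x ≤ a` and
`b ≤ y` say precisely that `(a, b)` is below `(x, y)` there. -/
lemma mem_of_addClosure_le (R : ObjectProperty (DerivedCategory.Bounded (Rep k (Gamma F))))
    [R.IsTriangulated] [R.IsClosedUnderIsomorphisms]
    (hR : addClosure (toBounded (tiltingRep k F)) ≤ R) (M : Rep k (Gamma F))
    (hM : ∀ p, FinProj (M.obj p)) : R (toBounded M) := by
  refine (map_ι_iff R (toBounded M)).1 ?_
  refine (isThick_single (R.map DerivedCategory.Bounded.ι)).mem_of_forall_finProj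
    (fun p : Gamma F => (OrderDual.toDual p.1.1, p.1.2)) ?_ tiltSet tiltSet_ordConnected
    (fun _ => ⟨le_rfl, le_rfl⟩) (fun _ _ h => h) (fun p N hN => ?_) M hM
  · intro p q h
    exact Subtype.ext h
  · exact (map_ι_iff R (toBounded _)).2 (hR _ (addClosure_cut_tiltSet F k p hN))

lemma triangulatedHull_tiltingRep :
    triangulatedHull (addClosure (toBounded (tiltingRep k F))) =
      perfect (k := k) (P := Gamma F) := by
  ext K
  constructor
  · intro h
    exact h _ inferInstance inferInstance (addClosure_le_perfect _ (tiltingRep_finProj F k))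
  · intro h R _ _ hR
    refine (map_ι_iff R K).1 ?_
    exact boundedResolved_le (R.map DerivedCategory.Bounded.ι) (fun M hM =>
      (map_ι_iff R (toBounded M)).2
        (mem_of_addClosure_le F k R hR M (finProj_of_finGenProj hM))) K.obj h

lemma injRep_mem_triangulatedHull (p : Gamma F) :
    triangulatedHull (addClosure (toBounded (tiltingRep k F))) (toBounded (injRep k p)) :=
  fun R _ _ hR => mem_of_addClosure_le F k R hR _ fun q =>
    ⟨inferInstanceAs (Module.Finite k (PLift (q ≤ p) → k)),
      .of_equiv (Finsupp.linearEquivFunOnFinite k k (PLift (q ≤ p)))⟩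

end Tilting

/-! ### Vanishing of the higher self-extensions of `T` -/

section Projective

variable {A : Type*} [Category* A] [Preadditive A]

lemma projective_of_sum {ι : Type*} [Fintype ι] {M : A} (Z : ι → A) (hZ : ∀ i, Projective (Z i))
    (a : ∀ i, M ⟶ Z i) (b : ∀ i, Z i ⟶ M) (h : ∑ i, a i ≫ b i = 𝟙 M) : Projective M where
  factors f e _ := ⟨∑ i, a i ≫ Projective.factorThru (b i ≫ f) e, by
    simp only [Preadditive.sum_comp, Category.assoc, Projective.factorThru_comp]
    simpa only [Preadditive.sum_comp, Category.assoc, Category.id_comp] using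
      congrArg (fun φ => φ ≫ f) h⟩

lemma projective_left_of_shortExact [Balanced A] {S : ShortComplex A} (hS : S.ShortExact)
    (h₂ : Projective S.X₂) (h₃ : Projective S.X₃) : Projective S.X₁ :=
  projective_of_sum (fun _ : Fin 1 => S.X₂) (fun _ => h₂) (fun _ => S.f)
    (fun _ => hS.splittingOfProjective.r) (by simp)

end Projective

section ExtVanishing

open Abelian

variable {A B : Type*} [Category* A] [Abelian A] [Category* B] [HasExt.{t} A]
  {L : A ⥤ B} {R : B ⥤ A}

/-- `Ext` groups with values in the image of a right adjoint vanish on objects with enough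
resolutions by projectives whose images by the left adjoint split. -/
lemma ext_eq_zero_of_adjunction (adj : L ⊣ R) (G : ObjectProperty A)
    (hG : ∀ M, G M → ∃ S : ShortComplex A, S.ShortExact ∧ S.X₃ = M ∧ Projective S.X₂ ∧ G S.X₁ ∧
      IsSplitMono (L.map S.f)) {M : A} (hM : G M) (N : B) (n : ℕ) (x : Ext M (R.obj N) (n + 1)) :
    x = 0 := by
  induction n generalizing M with
  | zero =>
    obtain ⟨S, hS, rfl, _, _, _⟩ := hG M hM
    obtain ⟨y, rfl⟩ := Ext.contravariant_sequence_exact₃ hS _ x (Ext.eq_zero_of_projective _)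
      (n₀ := 0) rfl
    obtain ⟨g, rfl⟩ := (Ext.mk₀_bijective _ _).surjective y
    -- The transpose of `g` extends along the split monomorphism `L.map S.f`; transposing back
    -- extends `g` along `S.f`. The connecting map kills such a `g`.
    obtain ⟨g', rfl⟩ : ∃ g' : S.X₂ ⟶ R.obj N, S.f ≫ g' = g := by
      refine ⟨adj.homEquiv _ _ (retraction (L.map S.f) ≫ (adj.homEquiv _ _).symm g), ?_⟩
      rw [← adj.homEquiv_naturality_left, IsSplitMono.id_assoc, Equiv.apply_symm_apply]
    rw [← Ext.mk₀_comp_mk₀, ← Ext.comp_assoc_of_second_deg_zero, hS.extClass_comp, Ext.zero_comp]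
  | succ n ih =>
    obtain ⟨S, hS, rfl, _, h₁, _⟩ := hG M hM
    obtain ⟨y, rfl⟩ := Ext.contravariant_sequence_exact₃ hS _ x (Ext.eq_zero_of_projective _)
      (n₀ := n + 1) (by lia)
    rw [ih h₁ y, Ext.comp_zero]

end ExtVanishing

section Shift

open DerivedCategory

variable {A : Type*} [Category* A] [Abelian A] [HasDerivedCategory.{t} A]

/-- For `i < 0` the target lives in degrees at least `-i > 0`, so the t-structure gives zero; for `i
> 0` the morphism is a class in `Ext`. -/
lemma toBounded_hom_shift_eq_zero {M N : A}
    (h : haveI := hasExt_of_hasDerivedCategory.{t} A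
      ∀ (n : ℕ) (x : Abelian.Ext.{t} M N (n + 1)), x = 0) (i : ℤ) (hi : i ≠ 0)
    (f : toBounded M ⟶ (shiftFunctor _ i).obj (toBounded N)) : f = 0 := by
  have := hasExt_of_hasDerivedCategory.{t} A
  refine ObjectProperty.hom_ext _ ?_
  let e := (Bounded.ι.commShiftIso (C := Bounded A) i).app (toBounded N)
  rw [← cancel_mono e.hom]
  let g : (singleFunctor A 0).obj M ⟶ ((singleFunctor A 0).obj N)⟦i⟧ := f.hom ≫ e.hom
  suffices g = 0 from this.trans zero_comp.symm
  obtain hi | hi := lt_or_gt_of_ne hi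
  · have : TStructure.t.IsGE (((singleFunctor A 0).obj N)⟦i⟧) (-i) :=
      TStructure.t.isGE_shift _ 0 i (-i) (by lia)
    exact TStructure.t.zero g 0 (-i) (by lia)
  · obtain ⟨n, rfl⟩ : ∃ n : ℕ, i = (n + 1 : ℕ) := ⟨(i - 1).toNat, by lia⟩
    obtain ⟨x, hx⟩ := (Abelian.Ext.homEquiv (X := M) (Y := N) (n := n + 1)).surjective g
    rw [← hx, h n x]
    exact Abelian.Ext.zero_hom _ _ _

end Shift

section Restriction

variable {k : Type w} [CommRing k]

section

variable {P : Type t} [PartialOrder P]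

lemma projective_cut_of_eq_empty {M : Rep k P} {C : Set P} {hC : C.OrdConnected} (h : C = ∅) :
    Projective (cut M C hC) :=
  Projective.of_iso (isZero_cut h).isoZero.symm inferInstance

lemma projective_cut_of_eq_Ici {N : ModuleCat.{w} k} [Projective N] {C : Set P}
    {hC : C.OrdConnected} {p : P} (h : C = Set.Ici p) :
    Projective (cut ((Functor.const P).obj N) C hC) := by
  subst h
  exact projective_cut_Ici p N

/-- The direct sum of the free representations on the values of a representation. -/
def freeCover [Finite P] (M : Rep k P) : Rep k P :=
  ⨁ fun p : P => cut ((Functor.const P).obj (M.obj p)) (Set.Ici p) Set.ordConnected_Ici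

/-- The canonical morphism from `freeCover M`. -/
def freeCoverπ [Finite P] (M : Rep k P) : freeCover M ⟶ M :=
  biproduct.desc fun p => cutDesc (𝟙 (M.obj p))

instance [Finite P] (M : Rep k P) : Epi (freeCoverπ M) := by
  have : ∀ p, Epi ((freeCoverπ M).app p) := fun p => by
    have h : NatTrans.app (biproduct.ι (fun p : P => cut ((Functor.const P).obj (M.obj p))
        (Set.Ici p) Set.ordConnected_Ici) p) p ≫ (freeCoverπ M).app p =
          (cutDesc (𝟙 (M.obj p))).app p :=
      congrArg (fun φ => NatTrans.app φ p) (biproduct.ι_desc (fun p => cutDesc (𝟙 (M.obj p))) p)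
    have hp : p ∈ Set.Ici p := Set.self_mem_Ici
    have : Epi ((cutDesc (𝟙 (M.obj p))).app p) := by
      rw [cutDesc_app _ hp]
      have : IsIso (homOfLE hp) := inferInstanceAs (IsIso (𝟙 p))
      infer_instance
    rw [← h] at this
    exact @epi_of_epi _ _ _ _ _ _ _ this
  exact NatTrans.epi_of_epi_app _

end

variable {X : Type u} {Y : Type v} [PartialOrder X] [PartialOrder Y] (F : Y →o LowerSet X)

/-- Restricting along `i_y` a truncated constant functor. -/
def restrictionCutIso (y : Y) (N : ModuleCat.{w} k) {C : Set (Gamma F)} (hC : C.OrdConnected) :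
    (restriction k F y).obj (cut ((Functor.const _).obj N) C hC) ≅
      cut ((Functor.const _).obj N) (incl F y ⁻¹' C) (hC.preimage_mono (incl F y).monotone) :=
  Iso.refl _

/-- The trace of `Set.Ici p` on the slice `F y` is a principal upper set if `p.1.2 ≤ y`, and empty
otherwise. -/
lemma projective_restriction_cut_Ici (y : Y) (N : ModuleCat.{w} k) [Projective N] (p : Gamma F) :
    Projective ((restriction k F y).obj
      (cut ((Functor.const _).obj N) (Set.Ici p) Set.ordConnected_Ici)) := by
  refine Projective.of_iso (restrictionCutIso F y N _).symm ?_
  by_cases h : p.1.2 ≤ y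
  · exact projective_cut_of_eq_Ici (p := baseChange F y p h)
      (Set.ext fun a => ⟨fun h' => h'.1, fun h' => ⟨h', h⟩⟩)
  · exact projective_cut_of_eq_empty (Set.eq_empty_of_forall_notMem fun a ha => h ha.2)

/-- The trace of `tiltSet p` on `F y` is the principal upper set of `p.1.1` or empty. It is empty
when `p.1.1 ∉ F y` because `F y` is a lower set. -/
lemma projective_restriction_tiltSummand (y : Y) (p : Gamma F) :
    Projective ((restriction k F y).obj (tiltSummand k p)) := by
  have := FinProj.self (k := k) |>.projective
  refine Projective.of_iso (restrictionCutIso F y _ _).symm ?_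
  by_cases h : y ≤ p.1.2 ∧ p.1.1 ∈ F y
  · exact projective_cut_of_eq_Ici (p := (⟨p.1.1, h.2⟩ : F y))
      (Set.ext fun a => ⟨fun h' => h'.1, fun h' => ⟨h', h.1⟩⟩)
  · exact projective_cut_of_eq_empty (Set.eq_empty_of_forall_notMem fun a ha =>
      h ⟨ha.2, (F y).lower ha.1 a.2⟩)

/-- The pointwise projective representations with projective restriction along `i_y`. -/
def restrictionProjective (y : Y) : ObjectProperty (Rep k (Gamma F)) := fun M =>
  (∀ p, Projective (M.obj p)) ∧ Projective ((restriction k F y).obj M)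

instance (y : Y) : (restriction k F y).Additive where

lemma restrictionProjective_of_sum (y : Y) {ι : Type*} [Fintype ι] {M : Rep k (Gamma F)}
    (Z : ι → Rep k (Gamma F)) (hZ : ∀ i, restrictionProjective F y (Z i))
    (a : ∀ i, M ⟶ Z i) (b : ∀ i, Z i ⟶ M) (h : ∑ i, a i ≫ b i = 𝟙 M) :
    restrictionProjective F y M := by
  refine ⟨fun p => projective_of_sum (fun i => (Z i).obj p) (fun i => (hZ i).1 p)
    (fun i => (a i).app p) (fun i => (b i).app p)
    (by simpa using congrArg (fun φ => NatTrans.app φ p) h),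
    projective_of_sum (fun i => (restriction k F y).obj (Z i)) (fun i => (hZ i).2)
    (fun i => (restriction k F y).map (a i)) (fun i => (restriction k F y).map (b i)) ?_⟩
  simpa using congrArg (restriction k F y).map h

lemma restrictionProjective_cut_Ici (y : Y) (N : ModuleCat.{w} k) [Projective N] (p : Gamma F) :
    restrictionProjective F y (cut ((Functor.const _).obj N) (Set.Ici p) Set.ordConnected_Ici) := by
  refine ⟨fun q => ?_, projective_restriction_cut_Ici F y N p⟩
  by_cases h : q ∈ Set.Ici p
  · exact Projective.of_iso (cutIso ((Functor.const _).obj N) Set.ordConnected_Ici h).symm ‹_›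
  · exact Projective.of_iso (isZero_cut_obj _ Set.ordConnected_Ici h).isoZero.symm inferInstance

lemma restrictionProjective_tiltSummand (y : Y) (p : Gamma F) :
    restrictionProjective F y (tiltSummand k p) := by
  have := FinProj.self (k := k) |>.projective
  refine ⟨fun q => ?_, projective_restriction_tiltSummand F y p⟩
  by_cases h : q ∈ tiltSet p
  · exact Projective.of_iso (cutIso _ (tiltSet_ordConnected p) h).symm this
  · exact Projective.of_iso (isZero_cut_obj _ (tiltSet_ordConnected p) h).isoZero.symm inferInstance

variable [Finite X] [Finite Y]

variable (k) in
lemma restrictionProjective_tiltingRep (y : Y) :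
    restrictionProjective F y (tiltingRep k F) :=
  have := Fintype.ofFinite (Gamma F)
  restrictionProjective_of_sum F y _ (restrictionProjective_tiltSummand F y) _ _
    (sum_tiltProj_tiltIncl F k)

/-- The kernel of the free cover stays in the class because the sequence splits at each point and,
`i_y⁻¹ M` being projective, also after restriction. That last splitting is the one required by
`ext_eq_zero_of_adjunction`. -/
lemma exists_shortExact_of_restrictionProjective (y : Y) (M : Rep k (Gamma F))
    (hM : restrictionProjective F y M) : ∃ S : ShortComplex (Rep k (Gamma F)), S.ShortExact ∧
      S.X₃ = M ∧ Projective S.X₂ ∧ restrictionProjective F y S.X₁ ∧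
      IsSplitMono ((restriction k F y).map S.f) := by
  have := Fintype.ofFinite (Gamma F)
  let S := ShortComplex.mk (kernel.ι (freeCoverπ M)) (freeCoverπ M) (kernel.condition _)
  have hS : S.ShortExact :=
    { exact := ShortComplex.exact_of_f_is_kernel _ (kernelIsKernel _)
      mono_f := inferInstanceAs (Mono (kernel.ι (freeCoverπ M)))
      epi_g := inferInstanceAs (Epi (freeCoverπ M)) }
  have hp := hM.1
  have hM₂ := hM.2
  have hev : ∀ p, (S.map ((evaluation _ (ModuleCat.{w} k)).obj p)).ShortExact := fun p =>
    hS.map_of_exact _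
  have hres : (S.map (restriction k F y)).ShortExact :=
    shortExact_of_eval _ fun x => hev (incl F y x)
  have h₂ : restrictionProjective F y (freeCover M) := restrictionProjective_of_sum F y _
    (fun p => restrictionProjective_cut_Ici F y (M.obj p) p) _ _ (biproduct_sum_eq_id _)
  have h₁ : restrictionProjective F y S.X₁ := ⟨fun p => projective_left_of_shortExact (hev p)
    (h₂.1 p) (hM.1 p), projective_left_of_shortExact hres h₂.2 hM.2⟩
  have : Projective (S.map (restriction k F y)).X₃ := hM.2
  refine ⟨S, hS, rfl, projective_of_sum _ (fun p => projective_cut_Ici p (M.obj p)) _ _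
    (biproduct_sum_eq_id _), h₁, ⟨⟨hres.splittingOfProjective.r, hres.splittingOfProjective.f_r⟩⟩⟩

/-- Only the second argument is decomposed: each of its summands is some `(i_y)_⋆ P_x`, while `T` as
a whole has projective restriction to `F y`. -/
lemma ext_tiltingRep_eq_zero [HasExt.{t} (Rep k (Gamma F))] (n : ℕ)
    (x : Abelian.Ext (tiltingRep k F) (tiltingRep k F) (n + 1)) : x = 0 := by
  have := Fintype.ofFinite (Gamma F)
  have hx : ∀ p : Gamma F, x.comp (.mk₀ (tiltProj k p ≫ tiltIncl k p)) (add_zero _) = 0 := by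
    rintro ⟨⟨a, y⟩, ha⟩
    let e := pushforwardProjIso (F := F) k y ⟨a, ha⟩
    have h := ext_eq_zero_of_adjunction (restrictionAdjunction k F y) _
      (exists_shortExact_of_restrictionProjective F y) (restrictionProjective_tiltingRep k F y)
      _ n (x.comp (.mk₀ (tiltProj k _ ≫ e.inv)) (add_zero _))
    have h' : tiltProj k (⟨(a, y), ha⟩ : Gamma F) ≫ tiltIncl k ⟨(a, y), ha⟩ =
        (tiltProj k _ ≫ e.inv) ≫ e.hom ≫ tiltIncl k _ := by simp
    rw [h', ← Abelian.Ext.mk₀_comp_mk₀, ← Abelian.Ext.comp_assoc_of_third_deg_zero, h,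
      Abelian.Ext.zero_comp]
  rw [← Abelian.Ext.comp_mk₀_id x, ← sum_tiltProj_tiltIncl F k, Abelian.Ext.mk₀_sum,
    Abelian.Ext.comp_sum]
  exact Finset.sum_eq_zero fun p _ => hx p

lemma isTiltingComplex_tiltingRep [HasDerivedCategory.{t} (Rep k (Gamma F))] :
    IsTiltingComplex (toBounded (tiltingRep k F)) where
  perfect := perfect_toBounded _ (tiltingRep_finProj F k)
  hom_shift_eq_zero := toBounded_hom_shift_eq_zero fun n x =>
    haveI := hasExt_of_hasDerivedCategory.{t} (Rep k (Gamma F))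
    ext_tiltingRep_eq_zero F n x
  generates := triangulatedHull_tiltingRep F k

end Restriction

/-! ### Endomorphism algebras of direct sums as matrix algebras -/

section EndAlgebras

variable {C D : Type*} [Category* C] [Preadditive C] [Category* D] [Preadditive D]

/-- A decomposition of an object as a finite direct sum. -/
structure SumDecomposition {I : Type*} [Fintype I] (A : I → C) (X : C) where
  /-- the inclusions of the summands -/
  ι : ∀ i, A i ⟶ X
  /-- the projections to the summands -/
  π : ∀ i, X ⟶ A i
  ι_π_self : ∀ i, ι i ≫ π i = 𝟙 (A i)
  ι_π_ne : ∀ ⦃i j⦄, i ≠ j → ι i ≫ π j = 0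
  sum_π_ι : ∑ i, π i ≫ ι i = 𝟙 X

namespace SumDecomposition

variable {I : Type*} [Fintype I] {A : I → C} {X : C} {B : I → D} {Y : D}

/-- A biproduct is a direct sum of its summands. -/
def biproduct [HasBiproduct A] : SumDecomposition A (⨁ A) where
  ι := biproduct.ι A
  π := biproduct.π A
  ι_π_self := biproduct.ι_π_self A
  ι_π_ne _ _ h := biproduct.ι_π_ne A h
  sum_π_ι := biproduct_sum_eq_id A

/-- Reindexing a direct sum decomposition. -/
def reindex {J : Type*} [Fintype J] (d : SumDecomposition A X) (e : J ≃ I) :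
    SumDecomposition (fun j => A (e j)) X where
  ι j := d.ι (e j)
  π j := d.π (e j)
  ι_π_self _ := d.ι_π_self _
  ι_π_ne _ _ h := d.ι_π_ne (e.injective.ne h)
  sum_π_ι := (e.sum_comp fun i => d.π i ≫ d.ι i).trans d.sum_π_ι

lemma sum_entries (d : SumDecomposition A X) (f : X ⟶ X) :
    ∑ i, ∑ j, d.π i ≫ (d.ι i ≫ f ≫ d.π j) ≫ d.ι j = f := by
  calc _ = (∑ i, d.π i ≫ d.ι i) ≫ f ≫ (∑ j, d.π j ≫ d.ι j) := by
        simp only [Preadditive.sum_comp, Preadditive.comp_sum, Category.assoc]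
        exact Finset.sum_comm
    _ = f := by rw [d.sum_π_ι, Category.id_comp, Category.comp_id]

lemma hom_ext (d : SumDecomposition A X) {f g : X ⟶ X}
    (h : ∀ i j, d.ι i ≫ f ≫ d.π j = d.ι i ≫ g ≫ d.π j) : f = g := by
  rw [← d.sum_entries f, ← d.sum_entries g]
  simp only [h]

lemma sum_entries_comp (d : SumDecomposition A X) (f g : X ⟶ X) (i l : I) :
    d.ι i ≫ (f ≫ g) ≫ d.π l = ∑ j, (d.ι i ≫ f ≫ d.π j) ≫ (d.ι j ≫ g ≫ d.π l) := by
  calc _ = (d.ι i ≫ f) ≫ (∑ j, d.π j ≫ d.ι j) ≫ g ≫ d.π l := by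
        rw [d.sum_π_ι, Category.id_comp, Category.assoc, Category.assoc]
    _ = _ := by simp only [Preadditive.sum_comp, Preadditive.comp_sum, Category.assoc]

lemma entry_add (d : SumDecomposition A X) (f g : X ⟶ X) (i j : I) :
    d.ι i ≫ (f + g) ≫ d.π j = d.ι i ≫ f ≫ d.π j + d.ι i ≫ g ≫ d.π j := by
  rw [Preadditive.add_comp, Preadditive.comp_add]

/-- The endomorphism with prescribed entries. -/
def ofEntries (d : SumDecomposition A X) (m : ∀ i j, A i ⟶ A j) : X ⟶ X :=
  ∑ i, ∑ j, d.π i ≫ m i j ≫ d.ι j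

lemma entry_ofEntries (d : SumDecomposition A X) (m : ∀ i j, A i ⟶ A j) (i j : I) :
    d.ι i ≫ d.ofEntries m ≫ d.π j = m i j := by
  classical
  simp only [ofEntries, Preadditive.sum_comp, Preadditive.comp_sum, Category.assoc]
  rw [Finset.sum_eq_single i, Finset.sum_eq_single j]
  · rw [d.ι_π_self, Category.comp_id, ← Category.assoc, d.ι_π_self, Category.id_comp]
  · intro l _ hl
    rw [d.ι_π_ne hl, comp_zero, comp_zero, comp_zero]
  · simp
  · intro l _ hl
    refine Finset.sum_eq_zero fun j' _ => ?_
    rw [← Category.assoc, d.ι_π_ne hl.symm, zero_comp]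
  · simp

variable {k : Type*} [CommRing k] [Linear k C]

lemma entry_smul (d : SumDecomposition A X) (r : k) (f : X ⟶ X) (i j : I) :
    d.ι i ≫ (r • f) ≫ d.π j = r • d.ι i ≫ f ≫ d.π j := by
  rw [Linear.smul_comp, Linear.comp_smul]

variable [Linear k D]

/-- Direct sums have isomorphic endomorphism algebras if the categories spanned by their summands
are isomorphic. -/
def endAlgEquiv (d : SumDecomposition A X) (d' : SumDecomposition B Y)
    (e : ∀ i j, (A i ⟶ A j) ≃ₗ[k] (B i ⟶ B j))
    (he : ∀ (i j l) (f : A i ⟶ A j) (g : A j ⟶ A l), e i l (f ≫ g) = e i j f ≫ e j l g) :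
    End X ≃ₐ[k] End Y :=
  let T : End X ≃ₗ[k] End Y :=
    { toFun := fun f : X ⟶ X => d'.ofEntries fun i j => e i j (d.ι i ≫ f ≫ d.π j)
      map_add' := fun f g => d'.hom_ext fun i j => by
        change _ = d'.ι i ≫ ((d'.ofEntries _) + (d'.ofEntries _)) ≫ d'.π j
        simp only [Preadditive.add_comp, Preadditive.comp_add, entry_ofEntries, ← map_add]
        exact congrArg (e i j) (d.entry_add f g i j)
      map_smul' := fun r f => d'.hom_ext fun i j => by
        change _ = d'.ι i ≫ (r • (d'.ofEntries _)) ≫ d'.π j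
        simp only [Linear.smul_comp, Linear.comp_smul, entry_ofEntries, ← map_smul]
        exact congrArg (e i j) (d.entry_smul r f i j)
      invFun := fun f : Y ⟶ Y => d.ofEntries fun i j => (e i j).symm (d'.ι i ≫ f ≫ d'.π j)
      left_inv := fun f => d.hom_ext fun i j => by
        simp only [entry_ofEntries, LinearEquiv.symm_apply_apply]
      right_inv := fun f => d'.hom_ext fun i j => by
        simp only [entry_ofEntries, LinearEquiv.apply_symm_apply] }
  have hT (f : X ⟶ X) (i j : I) : d'.ι i ≫ (show Y ⟶ Y from T f) ≫ d'.π j =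
    e i j (d.ι i ≫ f ≫ d.π j) := entry_ofEntries _ _ _ _
  -- Units are preserved automatically: if `e g = 𝟙`, then `𝟙 = e (𝟙 ≫ g) = e 𝟙 ≫ e g = e 𝟙`.
  have he_id (i : I) : e i i (𝟙 _) = 𝟙 _ := by
    obtain ⟨g, hg⟩ := (e i i).surjective (𝟙 (B i))
    have := he i i i (𝟙 _) g
    rwa [Category.id_comp, hg, Category.comp_id, eq_comm] at this
  AlgEquiv.ofLinearEquiv T
    (d'.hom_ext fun i j => by
      refine (hT (𝟙 X) i j).trans ?_
      change _ = d'.ι i ≫ 𝟙 Y ≫ d'.π j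
      rw [Category.id_comp, Category.id_comp]
      by_cases h : i = j
      · subst h
        rw [d.ι_π_self, d'.ι_π_self, he_id]
      · rw [d.ι_π_ne h, d'.ι_π_ne h, map_zero])
    (fun f g => d'.hom_ext fun i l => by
      -- In `End` the product `f * g` is `g ≫ f`.
      refine (hT (g ≫ f) i l).trans ?_
      refine Eq.trans ?_ (d'.sum_entries_comp (T g) (T f) i l).symm
      rw [d.sum_entries_comp, map_sum]
      exact Finset.sum_congr rfl fun j _ => (he i j l _ _).trans
        (congrArg₂ (· ≫ ·) (hT g i j).symm (hT f j l).symm))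

end SumDecomposition

/-- Fully faithful linear functors induce isomorphisms of endomorphism algebras. -/
def endAlgEquivOfFullyFaithful (k : Type*) [CommRing k] [Linear k C] [Linear k D] {G : C ⥤ D}
    [G.Additive] [G.Linear k] (hG : G.FullyFaithful) (X : C) : End X ≃ₐ[k] End (G.obj X) :=
  .ofLinearEquiv (.ofBijective (G.mapLinearMap k : (X ⟶ X) →ₗ[k] (G.obj X ⟶ G.obj X))
    (hG.map_bijective X X)) (G.map_id X) fun f g => G.map_comp g f

end EndAlgebras

/-! ### Morphisms between the summands and the category `kΓ₀` -/

section TiltingHoms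

variable {k : Type w} [CommRing k]

section

variable {P : Type t} [PartialOrder P] {C D : Set P} {hC : C.OrdConnected} {hD : D.OrdConnected}
  {N N' : ModuleCat.{w} k}

/-- The components of morphisms between truncated constant functors. -/
def cutConstApp (f : cut ((Functor.const P).obj N) C hC ⟶ cut ((Functor.const P).obj N') D hD)
    {q : P} (hqC : q ∈ C) (hqD : q ∈ D) : N ⟶ N' :=
  (cutIso ((Functor.const P).obj N) hC hqC).inv ≫ f.app q ≫
    (cutIso ((Functor.const P).obj N') hD hqD).hom

lemma app_eq_cutConstApp
    (f : cut ((Functor.const P).obj N) C hC ⟶ cut ((Functor.const P).obj N') D hD)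
    {q : P} (hqC : q ∈ C) (hqD : q ∈ D) :
    f.app q = (cutIso _ hC hqC).hom ≫ cutConstApp f hqC hqD ≫ (cutIso _ hD hqD).inv := by
  simp [cutConstApp]

lemma cutConstApp_zero {q : P} (hqC : q ∈ C) (hqD : q ∈ D) :
    cutConstApp (0 : cut ((Functor.const P).obj N) C hC ⟶ cut ((Functor.const P).obj N') D hD)
      hqC hqD = 0 := by
  simp [cutConstApp]

lemma cutConstApp_cutMap (η : N ⟶ N') (h : CutCompatible C D) {q : P} (hqC : q ∈ C)
    (hqD : q ∈ D) :
    cutConstApp (cutMap ((Functor.const P).map η) hC hD h) hqC hqD = η := by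
  simp [cutConstApp, cutMap_app _ _ hqC hqD]

lemma cut_const_hom_ext
    {f g : cut ((Functor.const P).obj N) C hC ⟶ cut ((Functor.const P).obj N') D hD}
    (h : ∀ q (hqC : q ∈ C) (hqD : q ∈ D), cutConstApp f hqC hqD = cutConstApp g hqC hqD) :
    f = g :=
  cut_hom_ext fun q hqC hqD => by
    rw [app_eq_cutConstApp f hqC hqD, app_eq_cutConstApp g hqC hqD, h]

lemma cutConstApp_eq_of_le
    (f : cut ((Functor.const P).obj N) C hC ⟶ cut ((Functor.const P).obj N') D hD)
    {q r : P} (h : q ≤ r) (hqC : q ∈ C) (hqD : q ∈ D) (hrC : r ∈ C) (hrD : r ∈ D) :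
    cutConstApp f hqC hqD = cutConstApp f hrC hrD := by
  have := f.naturality (homOfLE h)
  rw [cut_map _ hqC hrC, cut_map _ hqD hrD, app_eq_cutConstApp f hqC hqD,
    app_eq_cutConstApp f hrC hrD] at this
  simpa using this.symm

/-- Naturality along `q ≤ r`: one side passes through the zero value of the target at `q`, the other
is the component at `r` up to isomorphism. -/
lemma cutConstApp_eq_zero_of_le_right
    (f : cut ((Functor.const P).obj N) C hC ⟶ cut ((Functor.const P).obj N') D hD)
    {q r : P} (h : q ≤ r) (hqC : q ∈ C) (hqD : q ∉ D) (hrC : r ∈ C) (hrD : r ∈ D) :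
    cutConstApp f hrC hrD = 0 := by
  have := f.naturality (homOfLE h)
  rw [cut_map _ hqC hrC, app_eq_cutConstApp f hrC hrD,
    (isZero_cut_obj _ hD hqD).eq_zero_of_tgt (f.app q), zero_comp] at this
  simpa using this

lemma cutConstApp_eq_zero_of_le_left
    (f : cut ((Functor.const P).obj N) C hC ⟶ cut ((Functor.const P).obj N') D hD)
    {q r : P} (h : q ≤ r) (hqC : q ∈ C) (hqD : q ∈ D) (hrC : r ∉ C) (hrD : r ∈ D) :
    cutConstApp f hqC hqD = 0 := by
  have := f.naturality (homOfLE h)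
  rw [cut_map _ hqD hrD, app_eq_cutConstApp f hqC hqD,
    (isZero_cut_obj _ hC hrC).eq_zero_of_src (f.app r), comp_zero] at this
  simpa using this.symm

end

variable {X : Type u} {Y : Type v} [PartialOrder X] [PartialOrder Y] {F : Y →o LowerSet X}

open GammaZero

lemma GammaZero.Rel.cutCompatible {k : Type w} {p q : GammaZero k F} (h : Rel q p) :
    CutCompatible (tiltSet p.pt) (tiltSet q.pt) := fun _ _ hrs hr hs =>
  ⟨fun _ => ⟨h.1.trans hr.1, hrs.2.trans hs.2⟩, fun _ => ⟨hr.1.trans hrs.1, hs.2.trans h.2.1⟩⟩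

open Classical in
/-- The map from the morphisms of `kΓ₀` to the morphisms between the summands of the tilting
complex. -/
def tiltMap (p q : GammaZero k F) : (q ⟶ p) →ₗ[k] (tiltSummand k p.pt ⟶ tiltSummand k q.pt) where
  toFun (c : homSubmodule q p) := if h : Rel q p then
    cutMap ((Functor.const _).map (c.1 • 𝟙 _)) _ _ h.cutCompatible else 0
  map_add' (c d : homSubmodule q p) := by
    by_cases h : Rel q p
    · simp only [dif_pos h]
      rw [← cutMap_add]
      congr 1
      exact NatTrans.ext (funext fun _ => add_smul c.1 d.1 _)
    · simp only [dif_neg h, add_zero]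
  map_smul' r (c : homSubmodule q p) := by
    by_cases h : Rel q p
    · simp only [dif_pos h]
      refine Eq.trans ?_ (cutMap_smul r _ _)
      congr 1
      exact NatTrans.ext (funext fun _ => mul_smul r c.1 _)
    · simp only [dif_neg h, smul_zero]

lemma tiltMap_of_rel {p q : GammaZero k F} (h : Rel q p) (c : homSubmodule q p) :
    tiltMap p q c = cutMap ((Functor.const _).map (c.1 • 𝟙 _)) _ _ h.cutCompatible := dif_pos h

lemma hom_eq_zero_of_not_rel {p q : GammaZero k F} (h : ¬ Rel q p) (c : q ⟶ p) : c = 0 :=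
  Subtype.ext (eq_zero_of_not_rel h c)

lemma tiltMap_comp {p q r : GammaZero k F} (d : q ⟶ p) (c : r ⟶ q) :
    tiltMap p r (c ≫ d) = tiltMap p q d ≫ tiltMap q r c := by
  by_cases hqp : Rel q p
  · by_cases hrq : Rel r q
    · by_cases hrp : Rel r p
      · refine (tiltMap_of_rel hrp _).trans ?_
        rw [tiltMap_of_rel hqp, tiltMap_of_rel hrq, cutMap_comp _ _ _ _ hrp.cutCompatible
          fun s hs hs' => show s ∈ tiltSet q.pt from
            ⟨hqp.1.trans hs.1, hs'.2.trans hrq.2.1⟩]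
        congr 1
        refine NatTrans.ext (funext fun _ => ?_)
        refine (congrArg (fun x : k => x • 𝟙 (ModuleCat.of k k)) (comp_val hrp c d)).trans ?_
        simp [mul_smul]
      · rw [hom_eq_zero_of_not_rel hrp (c ≫ d), map_zero]
        -- The composite is zero because the supports are disjoint: a common point `(a, b)` would
        -- give `p.pt.1.1 ∈ F b ⊆ F r.pt.1.2`, hence `Rel r p`.
        exact cut_hom_ext fun s hs hs' => (hrp ⟨hrq.1.trans hqp.1, hrq.2.1.trans hqp.2.1,
          F.monotone hs'.2 ((F _).lower hs.1 s.2)⟩).elim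
    · rw [hom_eq_zero_of_not_rel hrq c, zero_comp, map_zero, map_zero, comp_zero]
  · rw [hom_eq_zero_of_not_rel hqp d, comp_zero, map_zero, map_zero, zero_comp]

lemma tiltMap_injective (p q : GammaZero k F) : Function.Injective (tiltMap p q) := by
  rw [injective_iff_map_eq_zero]
  intro c hc
  by_cases h : Rel q p
  · let s : Gamma F := ⟨(p.pt.1.1, q.pt.1.2), h.2.2⟩
    have hsp : s ∈ tiltSet p.pt := ⟨le_rfl, h.2.1⟩
    have hsq : s ∈ tiltSet q.pt := ⟨h.1, le_rfl⟩
    rw [tiltMap_of_rel h] at hc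
    have := cutConstApp_cutMap (hC := tiltSet_ordConnected p.pt) (hD := tiltSet_ordConnected q.pt)
      ((show homSubmodule q p from c).1 • 𝟙 (ModuleCat.of k k)) h.cutCompatible hsp hsq
    rw [hc] at this
    have h₁ : (0 : ModuleCat.of k k ⟶ ModuleCat.of k k) =
      (show homSubmodule q p from c).1 • 𝟙 (ModuleCat.of k k) := by
        rw [← this, cutConstApp_zero]
    refine Subtype.ext ?_
    have h₂ := congrArg (fun φ => φ.hom (1 : k)) h₁
    exact ((mul_one _).symm.trans h₂.symm)
  · exact hom_eq_zero_of_not_rel h c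

lemma tiltMap_surjective (p q : GammaZero k F) : Function.Surjective (tiltMap p q) := by
  intro f
  -- A common point `(a, b)` slides down to `r₀ = (p.pt.1.1, b)`, which stays in `Γ` because `F b`
  -- is a lower set.
  have key (r : Gamma F) (hr : r ∈ tiltSet p.pt) (hr' : r ∈ tiltSet q.pt) :
      ∃ r₀ ≤ r, r₀ ∈ tiltSet p.pt ∧ r₀.1.1 = p.pt.1.1 ∧ r₀.1.2 ≤ q.pt.1.2 :=
    ⟨⟨(p.pt.1.1, r.1.2), (F _).lower hr.1 r.2⟩, ⟨hr.1, le_rfl⟩, ⟨le_rfl, hr.2⟩, rfl, hr'.2⟩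
  by_cases h : Rel q p
  · let s : Gamma F := ⟨(p.pt.1.1, q.pt.1.2), h.2.2⟩
    have hsp : s ∈ tiltSet p.pt := ⟨le_rfl, h.2.1⟩
    have hsq : s ∈ tiltSet q.pt := ⟨h.1, le_rfl⟩
    refine ⟨(⟨(cutConstApp f hsp hsq).hom (1 : k), mem_of_rel h _⟩ : homSubmodule q p), ?_⟩
    rw [tiltMap_of_rel h]
    refine cut_const_hom_ext fun r hr hr' => ?_
    rw [cutConstApp_cutMap]
    obtain ⟨r₀, hr₀, hp, h₁, h₂⟩ := key r hr hr'
    have hq : r₀ ∈ tiltSet q.pt := ⟨h.1.trans hp.1, h₂⟩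
    -- The component at `r` is compared with the one at the corner `s` through `r₀`, which is below
    -- both.
    rw [← cutConstApp_eq_of_le f hr₀ hp hq hr hr',
      cutConstApp_eq_of_le f (show r₀ ≤ s from ⟨h₁.le, h₂⟩) hp hq hsp hsq]
    refine ModuleCat.hom_ext (LinearMap.ext_ring ?_)
    exact mul_one _
  · refine ⟨0, (map_zero _).trans (cut_const_hom_ext fun r hr hr' => ?_)⟩
    obtain ⟨r₀, hr₀, hp, h₁, h₂⟩ := key r hr hr'
    rw [cutConstApp_zero, eq_comm]
    -- If `r₀` is outside the support of `q`, naturality along `r₀ ≤ r` kills the component.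
    -- Otherwise the corner `s` is in `Γ` and in the support of `q`, but not in that of `p` since
    -- `Rel q p` fails, and naturality along `r₀ ≤ s` kills it.
    by_cases hq : r₀ ∈ tiltSet q.pt
    · rw [← cutConstApp_eq_of_le f hr₀ hp hq hr hr']
      let s : Gamma F := ⟨(p.pt.1.1, q.pt.1.2), F.monotone h₂ (h₁ ▸ r₀.2)⟩
      have hs : q.pt.1.1 ≤ p.pt.1.1 := hq.1.trans h₁.le
      exact cutConstApp_eq_zero_of_le_left f (show r₀ ≤ s from ⟨h₁.le, h₂⟩) hp hq
        (fun h' => h ⟨hs, h'.2, s.2⟩) ⟨hs, le_rfl⟩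
    · exact cutConstApp_eq_zero_of_le_right f hr₀ hp hq hr hr'

/-- The morphisms between the summands of the tilting complex. -/
def tiltMapEquiv (p q : GammaZero k F) :
    (q ⟶ p) ≃ₗ[k] (tiltSummand k p.pt ⟶ tiltSummand k q.pt) :=
  .ofBijective (tiltMap p q) ⟨tiltMap_injective p q, tiltMap_surjective p q⟩

variable (k) in
/-- The linear Yoneda embedding on morphisms, as a linear map. -/
def linearCoyonedaMap {C : Type*} [Category.{w} C] [Preadditive C] [Linear k C] (p q : C) :
    (q ⟶ p) →ₗ[k]
      ((linearCoyoneda k C).obj (.op p) ⟶ (linearCoyoneda k C).obj (.op q)) where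
  toFun f := (linearCoyoneda k C).map f.op
  map_add' f g := by
    refine NatTrans.ext (funext fun x => ModuleCat.hom_ext (LinearMap.ext fun h => ?_))
    exact Preadditive.add_comp _ _ _ f g h
  map_smul' r f := by
    refine NatTrans.ext (funext fun x => ModuleCat.hom_ext (LinearMap.ext fun h => ?_))
    exact Linear.smul_comp _ _ _ r f h

/-- The linear Yoneda lemma for morphisms between representable functors. -/
def linearCoyonedaEquiv {C : Type*} [Category.{w} C] [Preadditive C] [Linear k C] (p q : C) :
    (q ⟶ p) ≃ₗ[k]
      ((linearCoyoneda k C).obj (.op p) ⟶ (linearCoyoneda k C).obj (.op q)) :=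
  .ofBijective (linearCoyonedaMap k p q)
    (((Functor.FullyFaithful.ofFullyFaithful (linearCoyoneda k C)).map_bijective _ _).comp
      (opEquiv (Opposite.op p) (Opposite.op q)).symm.bijective)

variable [Finite X] [Finite Y]

variable (F k) in
/-- The tilting complex as the direct sum of its summands. -/
def tiltingRepDecomposition [Fintype (Gamma F)] :
    SumDecomposition (fun p : Gamma F => tiltSummand k p) (tiltingRep k F) where
  ι := tiltIncl k
  π := tiltProj k
  ι_π_self := tiltIncl_tiltProj_self k
  ι_π_ne _ _ := tiltIncl_tiltProj_of_ne k
  sum_π_ι := sum_tiltProj_tiltIncl F k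

variable (F k) in
-- `tiltMapEquiv` and Yoneda both reverse composition in `kΓ₀`, so going from one to the other
-- preserves it.
lemma nonempty_endAlgEquiv_projSumZero :
    Nonempty (End (tiltingRep k F) ≃ₐ[k] End (projSumZero k F).obj) := by
  have := Fintype.ofFinite (Gamma F)
  have := Fintype.ofFinite (GammaZero k F)
  let e : GammaZero k F ≃ Gamma F := ⟨GammaZero.pt, GammaZero.mk, fun _ => rfl, fun _ => rfl⟩
  refine ⟨((tiltingRepDecomposition k F).reindex e).endAlgEquiv (.biproduct (A := fun p =>
      (linearCoyoneda k (GammaZero k F)).obj (Opposite.op p)))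
    (fun p q => (tiltMapEquiv p q).symm.trans (linearCoyonedaEquiv p q)) fun p q r f g => ?_⟩
  obtain ⟨d, rfl⟩ := (tiltMapEquiv p q).surjective f
  obtain ⟨c, rfl⟩ := (tiltMapEquiv q r).surjective g
  have h : tiltMapEquiv p q d ≫ tiltMapEquiv q r c = tiltMapEquiv p r (c ≫ d) :=
    (tiltMap_comp d c).symm
  rw [h]
  simp only [LinearEquiv.trans_apply, LinearEquiv.symm_apply_apply]
  exact (linearCoyoneda k (GammaZero k F)).map_comp d.op c.op

end TiltingHoms

end

end PosetTilting

open PosetTilting in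
theorem proposition5p2 {k : Type w} [CommRing k] {X : Type u} {Y : Type v}
    [PartialOrder X] [PartialOrder Y] [Finite X] [Finite Y] (F : Y →o LowerSet X)
    [HasDerivedCategory.{t} (Rep k (Gamma F))] :
    IsTiltingComplex (toBounded (tiltingRep k F)) ∧
    (∀ p : Gamma F,
      triangulatedHull (addClosure (toBounded (tiltingRep k F))) (toBounded (injRep k p))) ∧
    Nonempty (End (toBounded (tiltingRep k F)) ≃ₐ[k] End (projSumZero k F)) := by
  refine ⟨isTiltingComplex_tiltingRep F, injRep_mem_triangulatedHull F k,
    (nonempty_endAlgEquiv_projSumZero k F).map fun e => ?_⟩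
  exact ((endAlgEquivOfFullyFaithful k (fullyFaithfulToBounded _) (tiltingRep k F)).symm.trans
    e).trans (endAlgEquivOfFullyFaithful k (ObjectProperty.fullyFaithfulι _)
      (projSumZero k F)).symm
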